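/- **Model.** An $N\times N$ input-queued switch operates in slots of unit length; in each slot each input sends at most one packet and each output receives at most one packet. Coflows arrive according to a Poisson process of rate $\lambda>0$. The $n$-th coflow is a random matrix $X^{(n)}=(X^{(n)}_{ij})\in\mathbb{N}^{N\times N}$, where $X^{(n)}_{ij}$ is its number of packets from input $i$ to output $j$; all $X^{(n)}_{ij}$ are independent of each other and of the arrival process, and the law $\nu^{N}_{ij}$ of $X^{(n)}_{ij}$ does not depend on $n$. The flow sizes are light-tailed, uniformly in $N$: there are $\theta>0$ and $C_0<\infty$, independent of $N$, such that $\mathbb{E}[e^{\theta\sum_j X_{ij}}]\le C_0$ for all $N,i$ and $\mathbb{E}[e^{\theta\sum_i X_{ij}}]\le C_0$ for all $N,j$. Put $\beta_N=\max\big(\max_i\sum_j\mathbb{E}X_{ij},\ \max_j\sum_i\mathbb{E}X_{ij}\big)$; the rate $\lambda$ is independent of $N$. For $B\in\mathbb{N}^{N\times N}$ the clearance time $\tau(B)$ is the largest row or column sum of $B$. An *optimal clearance algorithm* assigns to each $B$ a sequence of schedules obeying the crossbar constraints, the first $\tau(B)$ of which transmit exactly $B$. The delay of a coflow is the number of slots,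 counted from the slot of its arrival on, until all of its packets have been transmitted; the *expected coflow-level delay* of a policy is $\limsup_{n}\frac1n\sum_{m<n}\mathbb{E}[W_m]$, where $W_m$ is the delay of the $m$-th coflow. The switch is *stable* if $\limsup_t\frac1t\sum_{s<t}\mathbb{E}[Q(s)]<\infty$, where $Q(s)$ is the total number of packets waiting at the beginning of slot $s$. **CAB policy with frame size $T$.** Slots are grouped into frames of $T$ slots. At the end of a frame the coflows that arrived in it are scanned in order of arrival, and a coflow is selected (*conforming*) if this keeps the clearance time of the sum of the selected matrices at most $T-1$. The selected batch is cleared by an optimal clearance algorithm in the first $T-1$ slots of the next frame. The other (*non-conforming*) coflows join a FIFO queue that is served in the last slot of each frame, one coflow at a time, each by an optimal clearance algorithm. **Theorem (Average Coflow-level Delay).** Optimal clearance algorithms exist for every $N$. Under the above assumptions, if there is $\rho<1$ with $\lambda\beta_N\le\rho$ for all $N$, then there are frame sizes $T=T_N\ge1$ with $T_N=O(\log N)$ such that, for every optimal clearance algorithm, the CAB policy with frame size $T_N$ is an admissible schedule that keeps the $N\times N$ switch stable for every $N$, and its expected coflow-level delay is $O(\log N)$ as $N\to\infty$. This scaling is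 optimal: for all $\lambda>0$ and $0<\rho<1$ there are flow-size laws satisfying the above assumptions with $\lambda\beta_N=\rho$ for all $N\ge1$, and a constant $c>0$, such that for all sufficiently large $N$, under every scheduling policy, every coflow has expected delay at least $c\log N$. -/

import Mathlib

open MeasureTheory ProbabilityTheory Filter Asymptotics
open scoped NNReal ENNReal Topology

universe u

noncomputable section

namespace Coflow

/-! ### Switch, coflows, clearance time -/

/-- Traffic matrix of an `N × N` switch: `B i j` packets from input `i` to output `j`. -/
abbrev Traffic (N : ℕ) : Type := Fin N → Fin N → ℕ

/-- Clearance time: the largest row or column sum. -/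
def clearanceTime {N : ℕ} (B : Traffic N) : ℕ :=
  max (Finset.univ.sup fun i => ∑ j, B i j) (Finset.univ.sup fun j => ∑ i, B i j)

/-- Crossbar constraints. Entries are natural numbers, so such a matrix is binary, with at most
one `1` in each row and each column. -/
def IsCrossbar {N : ℕ} (S : Traffic N) : Prop :=
  (∀ i, ∑ j, S i j ≤ 1) ∧ (∀ j, ∑ i, S i j ≤ 1)

/-- An optimal clearance algorithm: it turns a traffic matrix `B` into a sequence of crossbar
schedules `G B 0, G B 1, …`, the first `clearanceTime B` of which clear `B` exactly. -/
def IsOptimalClearance {N : ℕ} (G : Traffic N → ℕ → Traffic N) : Prop :=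
  ∀ B, (∀ r, IsCrossbar (G B r)) ∧ ∑ r ∈ Finset.range (clearanceTime B), G B r = B

/-! ### Sample paths and schedules

A sample path is a pair `(a, x)`: `a t` is the number of coflows that arrive before the beginning
of slot `t` (slots `0, …, t - 1`), and `x n` is the traffic matrix of the `n`-th coflow in the order
of arrival (`n = 0, 1, …`). Coflow `n` arrives in the slot `t` with `a t ≤ n < a (t + 1)`.

A schedule `σ` is recorded per coflow: `σ t n i j` is the number of packets of coflow `n` that are
sent from input `i` to output `j` in slot `t`. -/

/-- Slot in which coflow `n` arrives. -/
def arrivalSlot (a : ℕ → ℕ) (n : ℕ) : ℕ := sInf {t | n < a (t + 1)}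

/-- Admissible schedules: crossbar constraints in every slot, only coflows that have arrived are
served, and no more packets of a coflow are sent than it has. -/
structure IsSchedule {N : ℕ} (a : ℕ → ℕ) (x : ℕ → Traffic N) (σ : ℕ → ℕ → Traffic N) : Prop where
  crossbar : ∀ t, IsCrossbar (∑ n ∈ Finset.range (a (t + 1)), σ t n)
  arrived : ∀ t n, a (t + 1) ≤ n → σ t n = 0
  volume : ∀ t n, ∑ s ∈ Finset.range t, σ s n ≤ x n

/-- Coflow-level delay of coflow `n`: the number of slots, counted from the slot of its arrival
on, until all of its packets have been transmitted (`⊤` if this never happens). -/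
def delay {N : ℕ} (a : ℕ → ℕ) (x : ℕ → Traffic N) (σ : ℕ → ℕ → Traffic N) (n : ℕ) : ℝ≥0∞ :=
  ⨅ (d : ℕ) (_ : x n ≤ ∑ s ∈ Finset.range (arrivalSlot a n + d), σ s n), (d : ℝ≥0∞)

/-- Total number of packets waiting in the switch at the beginning of slot `t`. -/
def backlog {N : ℕ} (a : ℕ → ℕ) (x : ℕ → Traffic N) (σ : ℕ → ℕ → Traffic N) (t : ℕ) : ℕ :=
  ∑ n ∈ Finset.range (a t), ∑ i, ∑ j, (x n i j - ∑ s ∈ Finset.range t, σ s n i j)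

/-! ### The Coflow-Aware Batching (CAB) policy with frames of `T` slots

Frame `k` consists of the slots `k * T, …, k * T + (T - 1)`. -/

/-- Scan the coflows `lo, lo + 1, …, lo + m - 1` in this order and select each one that keeps the
clearance time of the selected traffic at most `T - 1`. -/
def greedySelect {N : ℕ} (T : ℕ) (x : ℕ → Traffic N) (lo : ℕ) : ℕ → Finset ℕ
  | 0 => ∅
  | m + 1 =>
    if clearanceTime (∑ n ∈ insert (lo + m) (greedySelect T x lo m), x n) < T then
      insert (lo + m) (greedySelect T x lo m)
    else greedySelect T x lo m

/-- The conforming coflows among those that arrive in frame `k`. -/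
def conforming {N : ℕ} (T : ℕ) (a : ℕ → ℕ) (x : ℕ → Traffic N) (k : ℕ) : Finset ℕ :=
  greedySelect T x (a (k * T)) (a ((k + 1) * T) - a (k * T))

/-- Coflow `n` arrives in some frame and is not conforming. -/
def IsNonconforming {N : ℕ} (T : ℕ) (a : ℕ → ℕ) (x : ℕ → Traffic N) (n : ℕ) : Prop :=
  ∃ k, a (k * T) ≤ n ∧ n < a ((k + 1) * T) ∧ n ∉ conforming T a x k

open Classical in
/-- First frame whose last slot is not used by the non-conforming coflows `0, …, n - 1`, which are
served one at a time in the order of arrival; each of them is available from the frame after that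
of its arrival on and occupies the last slot of as many consecutive frames as its clearance time. -/
def fifoFree {N : ℕ} (T : ℕ) (a : ℕ → ℕ) (x : ℕ → Traffic N) : ℕ → ℕ
  | 0 => 0
  | n + 1 =>
    if IsNonconforming T a x n then
      max (arrivalSlot a n / T + 1) (fifoFree T a x n) + clearanceTime (x n)
    else fifoFree T a x n

/-- Frame in which the service of the non-conforming coflow `n` begins. -/
def fifoStart {N : ℕ} (T : ℕ) (a : ℕ → ℕ) (x : ℕ → Traffic N) (n : ℕ) : ℕ :=
  max (arrivalSlot a n / T + 1) (fifoFree T a x n)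

/-- Batch service: packets of the coflow `n ∈ s` sent in the `r`-th slot, when the aggregate
traffic of the coflows in `s` is cleared with the algorithm `G` and each virtual output queue
sends its packets in the order of arrival of the coflows. -/
def batchService {N : ℕ} (G : Traffic N → ℕ → Traffic N) (x : ℕ → Traffic N) (s : Finset ℕ)
    (r n : ℕ) : Traffic N := fun i j =>
  let B : Traffic N := ∑ m ∈ s, x m
  let sent : ℕ := ∑ q ∈ Finset.range r, G B q i j
  let ahead : ℕ := ∑ m ∈ s with m < n, x m i j
  if n ∈ s ∧ ahead ≤ sent ∧ sent < ahead + x n i j then G B r i j else 0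

open Classical in
/-- The CAB schedule with frame size `T` and optimal clearance algorithm `G`: the first `T - 1`
slots of frame `k + 1` clear the conforming coflows of frame `k`, the last slot of every frame
serves the FIFO queue of non-conforming coflows. -/
def cab {N : ℕ} (G : Traffic N → ℕ → Traffic N) (T : ℕ) (a : ℕ → ℕ) (x : ℕ → Traffic N)
    (t n : ℕ) : Traffic N :=
  if t % T + 1 < T then
    match t / T with
    | 0 => 0
    | k + 1 => batchService G x (conforming T a x k) (t % T) n
  else if IsNonconforming T a x n ∧ fifoStart T a x n ≤ t / T ∧
      t / T < fifoStart T a x n + clearanceTime (x n) then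
    G (x n) (t / T - fifoStart T a x n)
  else 0

/-! ### Stochastic assumptions -/

/-- `A` is (the counting process of) a Poisson process of rate `lam`. -/
structure IsPoissonProcess {Ω : Type u} [MeasurableSpace Ω] (A : ℝ≥0 → Ω → ℕ) (lam : ℝ≥0)
    (μ : Measure Ω) : Prop where
  measurable : ∀ t, Measurable (A t)
  zero : ∀ ω, A 0 ω = 0
  mono : ∀ ω, Monotone fun t => A t ω
  rightCont : ∀ ω t, ContinuousWithinAt (fun s => A s ω) (Set.Ici t) t
  increments : ∀ s t, s ≤ t →
    HasLaw (fun ω => A t ω - A s ω) (poissonMeasure (lam * (t - s))) μ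
  indep : HasIndepIncrements A μ

/-- Coflow arrivals: Poisson arrivals of rate `lam`, all flow sizes (within a coflow and of
different coflows) independent, the size from `i` to `j` with law `ν i j`, and flow sizes
independent of the arrival process. -/
structure IsCoflowTraffic {Ω : Type u} [MeasurableSpace Ω] {N : ℕ} (μ : Measure Ω) (lam : ℝ≥0)
    (ν : Fin N → Fin N → ProbabilityMeasure ℕ) (A : ℝ≥0 → Ω → ℕ) (X : ℕ → Ω → Traffic N) :
    Prop where
  poisson : IsPoissonProcess A lam μ
  measurable : ∀ n, Measurable (X n)
  law : ∀ n i j, HasLaw (fun ω => X n ω i j) (ν i j : Measure ℕ) μ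
  indep : iIndepFun (fun (p : ℕ × Fin N × Fin N) ω => X p.1 ω p.2.1 p.2.2) μ
  indepArrivals : IndepFun (fun ω t => A t ω) (fun ω n => X n ω) μ

/-- Number of coflows arriving before the beginning of slot `t`. -/
def slotCount {Ω : Type u} (A : ℝ≥0 → Ω → ℕ) (ω : Ω) (t : ℕ) : ℕ := A (t : ℝ≥0) ω

/-- `β`: the largest mean number of packets that a coflow brings to an input or output port. -/
def meanLoad {N : ℕ} (ν : Fin N → Fin N → ProbabilityMeasure ℕ) : ℝ≥0∞ :=
  max (⨆ i, ∑ j, ∫⁻ y, (y : ℝ≥0∞) ∂(ν i j : Measure ℕ))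
    (⨆ j, ∑ i, ∫⁻ y, (y : ℝ≥0∞) ∂(ν i j : Measure ℕ))

/-- Light-tailed flow sizes, uniformly in the size of the switch: at some `θ > 0` the moment
generating functions of all row and column sums of a coflow are bounded by one constant. -/
def IsLightTailed (ν : (N : ℕ) → Fin N → Fin N → ProbabilityMeasure ℕ) : Prop :=
  ∃ θ : ℝ, 0 < θ ∧ ∃ C : ℝ≥0, ∀ N,
    (∀ i, ∫⁻ y : Fin N → ℕ, ENNReal.ofReal (Real.exp (θ * ∑ j, (y j : ℝ)))
      ∂(Measure.pi fun j => (ν N i j : Measure ℕ)) ≤ C) ∧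
    (∀ j, ∫⁻ y : Fin N → ℕ, ENNReal.ofReal (Real.exp (θ * ∑ i, (y i : ℝ)))
      ∂(Measure.pi fun i => (ν N i j : Measure ℕ)) ≤ C)

/-! ### Performance of a (random) schedule -/

/-- Expected coflow-level delay of coflow `n`. -/
def expectedDelay {Ω : Type u} [MeasurableSpace Ω] {N : ℕ} (μ : Measure Ω) (A : ℝ≥0 → Ω → ℕ)
    (X : ℕ → Ω → Traffic N) (σ : Ω → ℕ → ℕ → Traffic N) (n : ℕ) : ℝ≥0∞ :=
  ∫⁻ ω, delay (slotCount A ω) (fun m => X m ω) (σ ω) n ∂μ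

/-- Long-run average over the coflows of the expected coflow-level delay. -/
def averageDelay {Ω : Type u} [MeasurableSpace Ω] {N : ℕ} (μ : Measure Ω) (A : ℝ≥0 → Ω → ℕ)
    (X : ℕ → Ω → Traffic N) (σ : Ω → ℕ → ℕ → Traffic N) : ℝ≥0∞ :=
  limsup (fun n : ℕ => (∑ m ∈ Finset.range n, expectedDelay μ A X σ m) / (n : ℝ≥0∞)) atTop

/-- (Strong) stability: the long-run average of the expected total backlog is finite. -/
def IsStable {Ω : Type u} [MeasurableSpace Ω] {N : ℕ} (μ : Measure Ω) (A : ℝ≥0 → Ω → ℕ)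
    (X : ℕ → Ω → Traffic N) (σ : Ω → ℕ → ℕ → Traffic N) : Prop :=
  limsup (fun t : ℕ => (∑ s ∈ Finset.range t,
    ∫⁻ ω, (backlog (slotCount A ω) (fun m => X m ω) (σ ω) s : ℝ≥0∞) ∂μ) / (t : ℝ≥0∞)) atTop < ⊤

/-- The random schedule produced by the CAB policy. -/
def cabPolicy {Ω : Type u} {N : ℕ} (G : Traffic N → ℕ → Traffic N) (T : ℕ) (A : ℝ≥0 → Ω → ℕ)
    (X : ℕ → Ω → Traffic N) (ω : Ω) : ℕ → ℕ → Traffic N :=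
  cab G T (slotCount A ω) (fun m => X m ω)

end Coflow

end

namespace Coflow

/-! ### Existence of optimal clearance algorithms -/

section Clearance

variable {ι : Type*} [Fintype ι]

/-! Optimal clearance is the Birkhoff–König theorem: a traffic matrix is padded to one with constant
row and column sums `clearanceTime B`, which splits into that many permutations
(`exists_crossbar_decomposition`).

For the upper bound, a conforming coflow is gone within `2 * T` slots, so everything depends on
overflowing frames being rare. The traffic of a frame at one port is a compound Poisson sum with
mean at most `rho * T`. Light tails give a Chernoff bound exponentially small in `T`, uniformly in
`N` and in the port. Since `T` is a large multiple of `log N`, this beats the factor `N ^ 3` that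
comes from the number of ports and from squaring the total traffic. Hence the second moment of
`overflow` is at most `1 / 4`, even after weighting by any function of the past (`exists_frameSize`,
resting on the independence statement `lintegral_past_mul`).

The FIFO queue is dominated by `workload`, a discrete queue fed by `overflow` and drained by one
unit per frame (`fifo_end_le`). A quadratic Lyapunov function bounds its mean over frames by a
constant (`drift`). The excess delay caused by frame `k` is at most `T * Y * (W + Y + 1)`, with `Y`
the overflow and `W` the workload. As `Y` is independent of `W`, the expected cost is `O(T)` per
frame (`sum_lintegral_overflow_cost_le`).

An average over the first `n` coflows involves the random set of frames that begin before `n`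
coflows have arrived. Whether a frame belongs to it is decided by the past, so the drift argument
survives multiplication by the indicator `early`. The expected number of such frames is at most `n /
(1 - exp (-lam))`, because every frame is nonempty with probability at least `1 - exp (-lam)`.
Stability is the same computation with `n = ⊤`, where each slot is charged the packets that are
still waiting.

For the lower bound, no schedule beats the clearance time of a coflow (`clearanceTime_le_delay`).
With independent geometric flows on the diagonal that time is at least the maximum of `N` i.i.d.
geometric variables, whose mean is of order `log N`. -/

/-- Hall's condition by counting mass: the rows of `s` carry `d * s.card`, all of it in neighbouring
columns, and each column holds only `d`. -/
lemma exists_perm_pos_of_regular (M : ι → ι → ℕ) {d : ℕ} (hd : 0 < d)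
    (hr : ∀ i, ∑ j, M i j = d) (hc : ∀ j, ∑ i, M i j = d) :
    ∃ e : Equiv.Perm ι, ∀ i, 0 < M i (e i) := by
  classical
  have hall := (Fintype.all_card_le_filter_rel_iff_exists_injective
    (fun i j : ι => 0 < M i j)).1 ?_
  · obtain ⟨f, hf, hpos⟩ := hall
    exact ⟨Equiv.ofBijective f (Finite.injective_iff_bijective.1 hf), hpos⟩
  · intro s
    set t : Finset ι := {b | ∃ a ∈ s, 0 < M a b} with ht
    refine Nat.le_of_mul_le_mul_right ?_ hd
    calc s.card * d = ∑ a ∈ s, ∑ b, M a b := by simp [hr]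
      _ = ∑ a ∈ s, ∑ b ∈ t, M a b := by
          refine Finset.sum_congr rfl fun a ha => ?_
          refine (Finset.sum_subset (Finset.subset_univ t) fun b _ hb => ?_).symm
          by_contra h
          exact hb (by simpa [ht] using ⟨a, ha, Nat.pos_of_ne_zero h⟩)
      _ = ∑ b ∈ t, ∑ a ∈ s, M a b := Finset.sum_comm
      _ ≤ ∑ b ∈ t, ∑ a, M a b :=
          Finset.sum_le_sum fun b _ => Finset.sum_le_sum_of_subset (Finset.subset_univ s)
      _ = t.card * d := by simp [hc]

/-- Removing a permutation inside the support lowers every row and column sum by exactly one, so the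
remainder is again regular. -/
lemma exists_perm_decomposition [DecidableEq ι] (d : ℕ) (M : ι → ι → ℕ)
    (hr : ∀ i, ∑ j, M i j = d) (hc : ∀ j, ∑ i, M i j = d) :
    ∃ P : ℕ → Equiv.Perm ι, ∀ i j, ∑ r ∈ Finset.range d, (if P r i = j then 1 else 0) = M i j := by
  induction d generalizing M with
  | zero =>
    refine ⟨fun _ => 1, fun i j => ?_⟩
    have := hr i
    simp only [Finset.sum_eq_zero_iff, Finset.mem_univ, true_imp_iff] at this
    simp [this j]
  | succ d ih =>
    obtain ⟨e, he⟩ := exists_perm_pos_of_regular M d.succ_pos hr hc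
    have hle : ∀ i j, (if e i = j then 1 else 0) ≤ M i j := by
      intro i j
      split_ifs with h
      · exact h ▸ he i
      · exact Nat.zero_le _
    obtain ⟨P, hP⟩ := ih (fun i j => M i j - if e i = j then 1 else 0) (fun i => by
        rw [Finset.sum_tsub_distrib _ fun j _ => hle i j, hr]; simp) (fun j => by
        rw [Finset.sum_tsub_distrib _ fun i _ => hle i j, hc]
        have : ∀ i, (e i = j) = (i = e.symm j) := fun i => by rw [Equiv.eq_symm_apply]
        simp [this])
    refine ⟨fun r => if r < d then P r else e, fun i j => ?_⟩
    rw [Finset.sum_range_succ]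
    simp only [lt_irrefl, if_false]
    rw [Finset.sum_congr rfl (g := fun r => if P r i = j then 1 else 0) fun r hr => by
      simp [Finset.mem_range.1 hr], hP]
    exact Nat.sub_add_cancel (hle i j)

end Clearance

section Decomposition

variable {N : ℕ}

lemma rowSum_le_clearanceTime (B : Traffic N) (i : Fin N) : ∑ j, B i j ≤ clearanceTime B :=
  le_max_of_le_left (Finset.le_sup (f := fun i => ∑ j, B i j) (Finset.mem_univ i))

lemma colSum_le_clearanceTime (B : Traffic N) (j : Fin N) : ∑ i, B i j ≤ clearanceTime B :=
  le_max_of_le_right (Finset.le_sup (f := fun j => ∑ i, B i j) (Finset.mem_univ j))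

lemma exists_crossbar_decomposition (B : Traffic N) : ∃ S : ℕ → Traffic N,
    (∀ r, IsCrossbar (S r)) ∧ ∑ r ∈ Finset.range (clearanceTime B), S r = B := by
  set d := clearanceTime B
  -- The `2N × 2N` matrix has `B` and its transpose as diagonal blocks. The off-diagonal blocks are
  -- diagonal matrices holding the row and column deficits, which brings every line sum to `d`.
  let M : Fin N ⊕ Fin N → Fin N ⊕ Fin N → ℕ := fun p q => match p, q with
    | .inl i, .inl j => B i j
    | .inl i, .inr j => if i = j then d - ∑ k, B i k else 0
    | .inr i, .inl j => if i = j then d - ∑ k, B k i else 0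
    | .inr i, .inr j => B j i
  obtain ⟨P, hP⟩ := exists_perm_decomposition d M
    (by
      rintro (i | i)
      · simp [M, Fintype.sum_sum_type, Nat.add_sub_cancel' (rowSum_le_clearanceTime B i), d]
      · simp [M, Fintype.sum_sum_type, Nat.sub_add_cancel (colSum_le_clearanceTime B i), d])
    (by
      rintro (i | i)
      · simp [M, Fintype.sum_sum_type, Nat.add_sub_cancel' (colSum_le_clearanceTime B i), d]
      · simp [M, Fintype.sum_sum_type, Nat.sub_add_cancel (rowSum_le_clearanceTime B i), d])
  refine ⟨fun r i j => if P r (.inl i) = .inl j then 1 else 0, fun r => ⟨fun i => ?_, fun j => ?_⟩,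
    ?_⟩
  · calc ∑ j, (if P r (.inl i) = .inl j then 1 else 0)
        ≤ ∑ q, (if P r (.inl i) = q then 1 else 0) := by
          rw [Fintype.sum_sum_type]; exact Nat.le_add_right _ _
      _ ≤ 1 := by simp
  · calc ∑ i, (if P r (.inl i) = .inl j then 1 else 0)
        ≤ ∑ p, (if p = (P r).symm (.inl j) then 1 else 0) := by
          rw [Fintype.sum_sum_type]
          simp only [Equiv.eq_symm_apply]
          exact Nat.le_add_right _ _
      _ ≤ 1 := by simp
  · funext i j
    simp only [Finset.sum_apply]
    exact hP (.inl i) (.inl j)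

lemma exists_isOptimalClearance (N : ℕ) :
    ∃ G : Traffic N → ℕ → Traffic N, IsOptimalClearance G := by
  choose G hG using fun B : Traffic N => exists_crossbar_decomposition B
  exact ⟨G, hG⟩

end Decomposition

/-! ### Clearance time and crossbar constraints -/

section Traffic

variable {N : ℕ}

/-- Total number of packets of a traffic matrix. -/
def packets (B : Traffic N) : ℕ := ∑ i, ∑ j, B i j

lemma clearanceTime_mono {B C : Traffic N} (h : B ≤ C) : clearanceTime B ≤ clearanceTime C := by
  refine max_le_max (Finset.sup_mono_fun fun i _ => ?_) (Finset.sup_mono_fun fun j _ => ?_)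
  · exact Finset.sum_le_sum fun j _ => h i j
  · exact Finset.sum_le_sum fun i _ => h i j

@[simp] lemma clearanceTime_zero : clearanceTime (0 : Traffic N) = 0 := by
  have h : (Finset.univ : Finset (Fin N)).sup (fun _ => 0) = 0 := Finset.sup_bot _
  simp [clearanceTime, h]

lemma clearanceTime_le_packets (B : Traffic N) : clearanceTime B ≤ packets B := by
  refine max_le (Finset.sup_le fun i _ => ?_) (Finset.sup_le fun j _ => ?_)
  · exact Finset.single_le_sum (f := fun i => ∑ j, B i j) (fun _ _ => Nat.zero_le _)
      (Finset.mem_univ i)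
  · rw [packets, Finset.sum_comm]
    exact Finset.single_le_sum (f := fun j => ∑ i, B i j) (fun _ _ => Nat.zero_le _)
      (Finset.mem_univ j)

lemma packets_sum {α : Type*} (s : Finset α) (x : α → Traffic N) :
    packets (∑ m ∈ s, x m) = ∑ m ∈ s, packets (x m) := by
  simp only [packets, Finset.sum_apply]
  have h : ∀ i, ∑ j, ∑ m ∈ s, x m i j = ∑ m ∈ s, ∑ j, x m i j := fun i => Finset.sum_comm
  simp only [h]
  exact Finset.sum_comm

lemma packets_eq_zero_iff {B : Traffic N} : packets B = 0 ↔ B = 0 := by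
  simp only [packets, Finset.sum_eq_zero_iff, Finset.mem_univ, true_imp_iff, funext_iff,
    Pi.zero_apply]

lemma IsCrossbar.mono {S S' : Traffic N} (hS : IsCrossbar S') (h : S ≤ S') : IsCrossbar S :=
  ⟨fun i => (Finset.sum_le_sum fun j _ => h i j).trans (hS.1 i),
    fun j => (Finset.sum_le_sum fun i _ => h i j).trans (hS.2 j)⟩

lemma isCrossbar_zero : IsCrossbar (0 : Traffic N) := ⟨by simp, by simp⟩

lemma IsCrossbar.apply_le_one {S : Traffic N} (hS : IsCrossbar S) (i j : Fin N) : S i j ≤ 1 :=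
  (Finset.single_le_sum (f := fun j => S i j) (fun _ _ => Nat.zero_le _)
    (Finset.mem_univ j)).trans (hS.1 i)

end Traffic

/-! ### Arrival slots and frames -/

section Arrivals

variable {T : ℕ} {a : ℕ → ℕ}

lemma lt_apply_arrivalSlot_succ {n t : ℕ} (h : n < a (t + 1)) : n < a (arrivalSlot a n + 1) :=
  Nat.sInf_mem (s := {t | n < a (t + 1)}) ⟨t, h⟩

lemma arrivalSlot_le {n t : ℕ} (h : n < a (t + 1)) : arrivalSlot a n ≤ t :=
  Nat.sInf_le (s := {t | n < a (t + 1)}) h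

lemma apply_le_of_lt_arrivalSlot {n t : ℕ} (h : t < arrivalSlot a n) : a (t + 1) ≤ n :=
  not_lt.1 (Nat.notMem_of_lt_sInf (s := {t | n < a (t + 1)}) h)

lemma le_arrivalSlot (ha : Monotone a) {n t t' : ℕ} (h : a t ≤ n) (h' : n < a (t' + 1)) :
    t ≤ arrivalSlot a n := by
  by_contra hlt
  exact absurd ((ha (show arrivalSlot a n + 1 ≤ t by omega)).trans h)
    (not_le.2 (lt_apply_arrivalSlot_succ h'))

/-- Coflow `n` arrives in frame `k`. -/
def InFrame (T : ℕ) (a : ℕ → ℕ) (k n : ℕ) : Prop := a (k * T) ≤ n ∧ n < a ((k + 1) * T)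

lemma InFrame.lt_succ (hT : 0 < T) {k n : ℕ} (h : InFrame T a k n) :
    n < a (((k + 1) * T - 1) + 1) := by
  rw [Nat.sub_add_cancel (Nat.mul_pos k.succ_pos hT)]; exact h.2

lemma InFrame.le_arrivalSlot (hT : 0 < T) (ha : Monotone a) {k n : ℕ} (h : InFrame T a k n) :
    k * T ≤ arrivalSlot a n :=
  Coflow.le_arrivalSlot ha h.1 (h.lt_succ hT)

lemma InFrame.arrivalSlot_lt (hT : 0 < T) {k n : ℕ} (h : InFrame T a k n) :
    arrivalSlot a n < (k + 1) * T := by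
  have := arrivalSlot_le (h.lt_succ hT)
  have : 0 < (k + 1) * T := Nat.mul_pos k.succ_pos hT
  omega

lemma InFrame.arrivalSlot_div (hT : 0 < T) (ha : Monotone a) {k n : ℕ} (h : InFrame T a k n) :
    arrivalSlot a n / T = k :=
  Nat.div_eq_of_lt_le (h.le_arrivalSlot hT ha) (h.arrivalSlot_lt hT)

lemma InFrame.unique (hT : 0 < T) (ha : Monotone a) {k l n : ℕ} (h : InFrame T a k n)
    (h' : InFrame T a l n) : k = l :=
  (h.arrivalSlot_div hT ha).symm.trans (h'.arrivalSlot_div hT ha)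

lemma exists_inFrame (ha0 : a 0 = 0) {n K : ℕ} (h : n < a (K * T)) :
    ∃ k < K, InFrame T a k n := by
  induction K with
  | zero => simp [ha0] at h
  | succ K ih =>
    by_cases hK : n < a (K * T)
    · obtain ⟨k, hk, hf⟩ := ih hK
      exact ⟨k, hk.trans K.lt_succ_self, hf⟩
    · exact ⟨K, K.lt_succ_self, not_lt.1 hK, h⟩

end Arrivals

/-! ### The greedy selection -/

section Greedy

variable {N T : ℕ} {a : ℕ → ℕ} {x : ℕ → Traffic N}

lemma greedySelect_subset (T : ℕ) (x : ℕ → Traffic N) (lo m : ℕ) :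
    greedySelect T x lo m ⊆ Finset.Ico lo (lo + m) := by
  induction m with
  | zero => simp [greedySelect]
  | succ m ih =>
    have h : greedySelect T x lo m ⊆ Finset.Ico lo (lo + (m + 1)) :=
      ih.trans (Finset.Ico_subset_Ico_right (by omega))
    rw [greedySelect]
    split_ifs
    · exact Finset.insert_subset (by simp) h
    · exact h

lemma clearanceTime_greedySelect_lt (hT : 0 < T) (x : ℕ → Traffic N) (lo m : ℕ) :
    clearanceTime (∑ n ∈ greedySelect T x lo m, x n) < T := by
  induction m with
  | zero => simpa [greedySelect] using hT
  | succ m ih =>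
    rw [greedySelect]
    split_ifs with h
    · exact h
    · exact ih

/-- The witness `q` is the moment of the scan at which `n` was considered; what is selected
afterwards does not matter. -/
lemma le_clearanceTime_of_notMem_greedySelect {lo m n : ℕ} (hn : n ∈ Finset.Ico lo (lo + m))
    (h : n ∉ greedySelect T x lo m) :
    ∃ q, lo + q = n ∧ T ≤ clearanceTime (∑ l ∈ insert n (greedySelect T x lo q), x l) := by
  induction m with
  | zero => simp at hn
  | succ m ih =>
    rw [greedySelect] at h
    rcases (show n = lo + m ∨ n ∈ Finset.Ico lo (lo + m) by
      simp only [Finset.mem_Ico] at hn ⊢; omega) with rfl | hn'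
    · refine ⟨m, rfl, ?_⟩
      split_ifs at h with hc
      · simp at h
      · exact not_lt.1 hc
    · refine ih hn' fun hmem => h ?_
      split_ifs
      · exact Finset.mem_insert_of_mem hmem
      · exact hmem

lemma conforming_subset (ha : Monotone a) (x : ℕ → Traffic N) (k : ℕ) :
    conforming T a x k ⊆ Finset.Ico (a (k * T)) (a ((k + 1) * T)) := by
  have h := greedySelect_subset T x (a (k * T)) (a ((k + 1) * T) - a (k * T))
  rwa [Nat.add_sub_cancel' (ha (Nat.mul_le_mul_right T k.le_succ))] at h

lemma inFrame_of_mem_conforming (ha : Monotone a) {k n : ℕ} (h : n ∈ conforming T a x k) :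
    InFrame T a k n := Finset.mem_Ico.1 (conforming_subset ha x k h)

lemma not_isNonconforming_of_mem (hT : 0 < T) (ha : Monotone a) {k n : ℕ}
    (h : n ∈ conforming T a x k) : ¬ IsNonconforming T a x n := by
  rintro ⟨l, h1, h2, h3⟩
  obtain rfl := (inFrame_of_mem_conforming ha h).unique hT ha ⟨h1, h2⟩
  exact h3 h

lemma IsNonconforming.notMem_conforming (hT : 0 < T) (ha : Monotone a) {n : ℕ}
    (h : IsNonconforming T a x n) (k : ℕ) : n ∉ conforming T a x k :=
  fun h' => not_isNonconforming_of_mem hT ha h' h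

/-- Aggregate traffic of the coflows that arrive in frame `k`. -/
def frameTraffic (T : ℕ) (a : ℕ → ℕ) (x : ℕ → Traffic N) (k : ℕ) : Traffic N :=
  ∑ m ∈ Finset.Ico (a (k * T)) (a ((k + 1) * T)), x m

/-- The selection that caused the rejection lies inside the frame, so the whole frame is at least as
large. An empty coflow would not have changed that selection, which fits. Nonemptiness later allows
a non-conforming coflow to be counted by its packets. -/
lemma IsNonconforming.le_clearanceTime_frameTraffic_and_ne_zero (ha : Monotone a) {n : ℕ}
    (h : IsNonconforming T a x n) {k : ℕ} (hT : 0 < T) (hk : InFrame T a k n) :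
    T ≤ clearanceTime (frameTraffic T a x k) ∧ x n ≠ 0 := by
  have hmono := ha (Nat.mul_le_mul_right T k.le_succ)
  have hn : n ∈ Finset.Ico (a (k * T)) (a (k * T) + (a ((k + 1) * T) - a (k * T))) := by
    rw [Nat.add_sub_cancel' hmono]; exact Finset.mem_Ico.2 hk
  obtain ⟨q, hq, hle⟩ := le_clearanceTime_of_notMem_greedySelect hn (h.notMem_conforming hT ha k)
  have hsub := greedySelect_subset T x (a (k * T)) q
  constructor
  · refine hle.trans (clearanceTime_mono ?_)
    refine Finset.sum_le_sum_of_subset (Finset.insert_subset (Finset.mem_Ico.2 hk) fun l hl => ?_)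
    have := Finset.mem_Ico.1 (hsub hl)
    have := hk.2
    exact Finset.mem_Ico.2 ⟨by omega, by omega⟩
  · intro h0
    have hnot : n ∉ greedySelect T x (a (k * T)) q := fun hl => by
      have := Finset.mem_Ico.1 (hsub hl); omega
    rw [Finset.sum_insert hnot, h0, zero_add] at hle
    exact absurd (clearanceTime_greedySelect_lt hT x _ _) (not_lt.2 hle)

end Greedy

/-! ### Batch service -/

section Batch

variable {N : ℕ} {G : Traffic N → ℕ → Traffic N} {x : ℕ → Traffic N} {s : Finset ℕ}

lemma sum_le_of_unique_ne_zero {α : Type*} {s : Finset α} {f : α → ℕ} {g : ℕ}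
    (hle : ∀ n, f n ≤ g) (huniq : ∀ m n, f m ≠ 0 → f n ≠ 0 → m = n) : ∑ n ∈ s, f n ≤ g := by
  by_cases h : ∃ m ∈ s, f m ≠ 0
  · obtain ⟨m, hm, hne⟩ := h
    rw [Finset.sum_eq_single_of_mem m hm fun n _ hn => by
      by_contra h0; exact hn (huniq n m h0 hne)]
    exact hle m
  · push Not at h
    rw [Finset.sum_eq_zero h]
    exact Nat.zero_le _

/-- In each virtual output queue, coflow `n` owns the packets numbered from `ahead` to `ahead + x n
i j`; these intervals are disjoint. -/
lemma ahead_add_le {m n : ℕ} (hm : m ∈ s) (hmn : m < n) (i j : Fin N) :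
    ∑ l ∈ s with l < m, x l i j + x m i j ≤ ∑ l ∈ s with l < n, x l i j := by
  rw [add_comm, ← Finset.sum_insert (s := s.filter (· < m)) (f := fun l => x l i j) (by simp)]
  refine Finset.sum_le_sum_of_subset (Finset.insert_subset (by simp [hm, hmn]) fun l hl => ?_)
  simp only [Finset.mem_filter] at hl ⊢
  exact ⟨hl.1, hl.2.trans hmn⟩

lemma sum_batchService_le (u : Finset ℕ) (r : ℕ) :
    ∑ n ∈ u, batchService G x s r n ≤ G (∑ m ∈ s, x m) r := by
  intro i j
  simp only [Finset.sum_apply]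
  refine sum_le_of_unique_ne_zero (fun n => ?_) fun m n hm hn => ?_
  · simp only [batchService]
    split_ifs
    · exact le_rfl
    · exact Nat.zero_le _
  · simp only [batchService, ne_eq, ite_eq_right_iff, Classical.not_imp] at hm hn
    obtain ⟨⟨hm, hm1, hm2⟩, -⟩ := hm
    obtain ⟨⟨hn, hn1, hn2⟩, -⟩ := hn
    rcases lt_trichotomy m n with h | h | h
    · have := ahead_add_le (x := x) hm h i j; omega
    · exact h
    · have := ahead_add_le (x := x) hn h i j; omega

lemma sum_range_batchService (hG : IsOptimalClearance G) {n : ℕ} (hn : n ∈ s) (i j : Fin N)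
    (r : ℕ) : ∑ q ∈ Finset.range r, batchService G x s q n i j =
      min (∑ q ∈ Finset.range r, G (∑ m ∈ s, x m) q i j - ∑ m ∈ s with m < n, x m i j)
        (x n i j) := by
  induction r with
  | zero => simp
  | succ r ih =>
    -- The counter of sent packets moves by at most one, so it cannot jump over an end of the
    -- interval owned by `n`; this makes the truncated formula exact.
    have h1 := ((hG (∑ m ∈ s, x m)).1 r).apply_le_one i j
    rw [Finset.sum_range_succ, ih, Finset.sum_range_succ]
    simp only [batchService, hn, true_and]
    split_ifs with h <;> omega

lemma sum_range_batchService_le (hG : IsOptimalClearance G) {n : ℕ} (hn : n ∈ s) (r : ℕ) :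
    ∑ q ∈ Finset.range r, batchService G x s q n ≤ x n := by
  intro i j
  simp only [Finset.sum_apply]
  rw [sum_range_batchService hG hn]
  exact min_le_right _ _

lemma sum_range_batchService_eq (hG : IsOptimalClearance G) {n : ℕ} (hn : n ∈ s) {r : ℕ}
    (hr : clearanceTime (∑ m ∈ s, x m) ≤ r) :
    ∑ q ∈ Finset.range r, batchService G x s q n = x n := by
  funext i j
  simp only [Finset.sum_apply]
  rw [sum_range_batchService hG hn, min_eq_right]
  have h1 : (∑ m ∈ s, x m) i j ≤ ∑ q ∈ Finset.range r, G (∑ m ∈ s, x m) q i j := by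
    conv_lhs => rw [← (hG (∑ m ∈ s, x m)).2]
    rw [Finset.sum_apply, Finset.sum_apply]
    exact Finset.sum_le_sum_of_subset (Finset.range_subset_range.2 hr)
  have h2 : ∑ l ∈ s with l < n, x l i j + x n i j ≤ (∑ m ∈ s, x m) i j := by
    rw [add_comm, ← Finset.sum_insert (s := s.filter (· < n)) (f := fun l => x l i j) (by simp),
      Finset.sum_apply, Finset.sum_apply]
    exact Finset.sum_le_sum_of_subset
      (Finset.insert_subset hn (Finset.filter_subset _ _))
  omega

end Batch

/-! ### The FIFO queue of non-conforming coflows -/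

section Cab

variable {N T : ℕ} {a : ℕ → ℕ} {x : ℕ → Traffic N} {G : Traffic N → ℕ → Traffic N}

lemma IsNonconforming.fifoFree_succ {n : ℕ} (h : IsNonconforming T a x n) :
    fifoFree T a x (n + 1) = fifoStart T a x n + clearanceTime (x n) := by
  rw [fifoFree, if_pos h, fifoStart]

lemma fifoFree_mono : Monotone (fifoFree T a x) := by
  refine monotone_nat_of_le_succ fun n => ?_
  rw [fifoFree]
  split_ifs
  · exact (le_max_right _ _).trans (Nat.le_add_right _ _)
  · exact le_rfl

lemma IsNonconforming.fifo_disjoint {m n : ℕ} (hm : IsNonconforming T a x m) (h : m < n) :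
    fifoStart T a x m + clearanceTime (x m) ≤ fifoStart T a x n := by
  rw [← hm.fifoFree_succ]
  exact (fifoFree_mono h).trans (le_max_right _ _)

/-! ### Service received under the CAB policy -/

/-- The `min` counts the batch slots of frame `k + 1` that are over by time `t`: truncated
subtraction gives `0` before that frame, and the cap `T - 1` skips its last slot. -/
lemma sum_range_cab_of_mem_conforming (hT : 0 < T) (ha : Monotone a) {k n : ℕ}
    (hn : n ∈ conforming T a x k) (t : ℕ) :
    ∑ s ∈ Finset.range t, cab G T a x s n =
      ∑ r ∈ Finset.range (min (t - (k + 1) * T) (T - 1)),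
        batchService G x (conforming T a x k) r n := by
  induction t with
  | zero => simp
  | succ t ih =>
    have hnc := not_isNonconforming_of_mem hT ha hn
    have hdm := Nat.div_add_mod t T
    have hmod := Nat.mod_lt t hT
    rw [Finset.sum_range_succ, ih]
    by_cases hlast : t % T + 1 < T
    · by_cases hk : t / T = k + 1
      · have hcab : cab G T a x t n = batchService G x (conforming T a x k) (t % T) n := by
          rw [cab, if_pos hlast, hk]
        rw [hk, mul_comm] at hdm
        rw [hcab, show min (t - (k + 1) * T) (T - 1) = t % T by omega,
          show min (t + 1 - (k + 1) * T) (T - 1) = t % T + 1 by omega, Finset.sum_range_succ]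
      · have hcab : cab G T a x t n = 0 := by
          rw [cab, if_pos hlast]
          rcases hq : t / T with _ | l
          · rfl
          · have hnl : n ∉ conforming T a x l := fun hl => by
              have := (inFrame_of_mem_conforming ha hl).unique hT ha
                (inFrame_of_mem_conforming ha hn)
              exact hk (by omega)
            funext i j
            simp [batchService, hnl]
        rw [hcab, add_zero]
        congr 2
        rcases Nat.lt_or_gt_of_ne hk with h | h
        · have : (t / T + 1) * T ≤ (k + 1) * T := Nat.mul_le_mul_right T h
          rw [add_mul, one_mul, mul_comm (t / T)] at this
          omega
        · have : (k + 2) * T ≤ t / T * T := Nat.mul_le_mul_right T h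
          rw [mul_comm (t / T), show (k + 2) * T = (k + 1) * T + T by ring] at this
          omega
    · have hcab : cab G T a x t n = 0 := by
        rw [cab, if_neg hlast, if_neg fun h => hnc h.1]
      rw [hcab, add_zero]
      congr 2
      rcases Nat.lt_or_ge (t / T) (k + 1) with h | h
      · have : (t / T + 1) * T ≤ (k + 1) * T := Nat.mul_le_mul_right T h
        rw [add_mul, one_mul, mul_comm (t / T)] at this
        omega
      · have : (k + 1) * T ≤ t / T * T := Nat.mul_le_mul_right T h
        rw [mul_comm (t / T)] at this
        omega

/-- The quotient `t / T` increases exactly when a last slot has passed, so it is the clock of the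
FIFO queue. -/
lemma sum_range_cab_of_isNonconforming (hT : 0 < T) (ha : Monotone a) {n : ℕ}
    (hn : IsNonconforming T a x n) (t : ℕ) :
    ∑ s ∈ Finset.range t, cab G T a x s n =
      ∑ r ∈ Finset.range (min (t / T - fifoStart T a x n) (clearanceTime (x n))), G (x n) r := by
  induction t with
  | zero => simp
  | succ t ih =>
    have hmod := Nat.mod_lt t hT
    rw [Finset.sum_range_succ, ih]
    by_cases hlast : t % T + 1 < T
    · have hcab : cab G T a x t n = 0 := by
        rw [cab, if_pos hlast]
        rcases t / T with _ | l
        · rfl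
        · have hnl := hn.notMem_conforming hT ha l
          funext i j
          simp [batchService, hnl]
      have hdiv : (t + 1) / T = t / T := by
        rw [Nat.succ_div, if_neg, add_zero]
        rw [Nat.dvd_iff_mod_eq_zero, Nat.add_mod, Nat.mod_eq_of_lt (show 1 < T by omega),
          Nat.mod_eq_of_lt hlast]
        omega
      rw [hcab, add_zero, hdiv]
    · have hdiv : (t + 1) / T = t / T + 1 := by
        rw [Nat.succ_div, if_pos]
        rw [Nat.dvd_iff_mod_eq_zero, ← Nat.mod_add_mod, show t % T + 1 = T by omega, Nat.mod_self]
      rw [hdiv, cab, if_neg hlast]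
      split_ifs with h
      · rw [show min (t / T + 1 - fifoStart T a x n) (clearanceTime (x n)) =
          min (t / T - fifoStart T a x n) (clearanceTime (x n)) + 1 by omega,
          Finset.sum_range_succ,
          show min (t / T - fifoStart T a x n) (clearanceTime (x n)) =
            t / T - fifoStart T a x n by omega]
      · rw [add_zero]
        congr 2
        have : ¬ (fifoStart T a x n ≤ t / T ∧ t / T < fifoStart T a x n + clearanceTime (x n)) :=
          fun h' => h ⟨hn, h'⟩
        omega

lemma sum_range_le_of_isOptimalClearance (hG : IsOptimalClearance G) (B : Traffic N) (r : ℕ) :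
    ∑ q ∈ Finset.range (min r (clearanceTime B)), G B q ≤ B := by
  conv_rhs => rw [← (hG B).2]
  exact Finset.sum_le_sum_of_subset (Finset.range_subset_range.2 (min_le_right _ _))

lemma cab_eq_zero_of_notMem {n : ℕ} (hc : ∀ k, n ∉ conforming T a x k)
    (hn : ¬ IsNonconforming T a x n) (t : ℕ) : cab G T a x t n = 0 := by
  rw [cab]
  split_ifs with h1 h2
  · rcases t / T with _ | l
    · rfl
    · funext i j
      simp [batchService, hc l]
  · exact absurd h2.1 hn
  · rfl

/-- The CAB policy is an admissible schedule. -/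
lemma isSchedule_cab (hG : IsOptimalClearance G) (hT : 0 < T) (ha : Monotone a) :
    IsSchedule a x (cab G T a x) where
  crossbar t := by
    by_cases hlast : t % T + 1 < T
    · rcases hq : t / T with _ | k
      · have : ∀ n, cab G T a x t n = 0 := fun n => by rw [cab, if_pos hlast, hq]
        simpa [this] using isCrossbar_zero
      · have : ∀ n, cab G T a x t n = batchService G x (conforming T a x k) (t % T) n :=
          fun n => by rw [cab, if_pos hlast, hq]
        simp only [this]
        exact ((hG _).1 _).mono (sum_batchService_le _ _)
    · by_cases h : ∃ n ∈ Finset.range (a (t + 1)), cab G T a x t n ≠ 0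
      · obtain ⟨n, hn, hne⟩ := h
        have key : ∀ m, cab G T a x t m ≠ 0 → IsNonconforming T a x m ∧
            fifoStart T a x m ≤ t / T ∧ t / T < fifoStart T a x m + clearanceTime (x m) := by
          intro m hm
          by_contra hcon
          exact hm (by rw [cab, if_neg hlast, if_neg hcon])
        -- The FIFO service windows are disjoint, so a last slot carries only one coflow.
        rw [Finset.sum_eq_single_of_mem n hn fun m _ hm => ?_]
        · rw [cab, if_neg hlast, if_pos (key n hne)]
          exact (hG _).1 _
        · by_contra h0
          obtain ⟨hm1, hm2, hm3⟩ := key m h0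
          obtain ⟨hn1, hn2, hn3⟩ := key n hne
          rcases Nat.lt_or_gt_of_ne hm with hlt | hlt
          · have := hm1.fifo_disjoint hlt; omega
          · have := hn1.fifo_disjoint hlt; omega
      · push Not at h
        rw [Finset.sum_eq_zero h]
        exact isCrossbar_zero
  arrived t n hn := by
    rw [cab]
    split_ifs with h1 h2
    · rcases hq : t / T with _ | k
      · rfl
      · have hnk : n ∉ conforming T a x k := fun hmem => by
          have h := (inFrame_of_mem_conforming ha hmem).2
          have : (k + 1) * T ≤ t := hq ▸ Nat.div_mul_le_self t T
          have := ha (this.trans t.le_succ)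
          simp only [Nat.succ_eq_add_one] at this
          omega
        funext i j
        simp [batchService, hnk]
    · obtain ⟨⟨k, hk1, hk2, -⟩, hs, -⟩ := h2
      have hf : InFrame T a k n := ⟨hk1, hk2⟩
      have h := (le_max_left _ _).trans hs
      rw [hf.arrivalSlot_div hT ha] at h
      have : (k + 1) * T ≤ t := (Nat.mul_le_mul_right T h).trans (Nat.div_mul_le_self t T)
      have := ha (this.trans t.le_succ)
      simp only [Nat.succ_eq_add_one] at this
      omega
    · rfl
  volume t n := by
    by_cases hn : IsNonconforming T a x n
    · rw [sum_range_cab_of_isNonconforming hT ha hn]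
      exact sum_range_le_of_isOptimalClearance hG _ _
    · by_cases hc : ∃ k, n ∈ conforming T a x k
      · obtain ⟨k, hk⟩ := hc
        rw [sum_range_cab_of_mem_conforming hT ha hk]
        exact sum_range_batchService_le hG hk _
      · push Not at hc
        simp only [cab_eq_zero_of_notMem hc hn, Finset.sum_const_zero]
        exact fun i j => Nat.zero_le _

/-! ### Workload of the FIFO queue -/

/-- Total traffic of frame `k` if it exceeds the capacity of a batch, and `0` otherwise. It bounds
the work that the non-conforming coflows of frame `k` bring. -/
def overflow (T : ℕ) (a : ℕ → ℕ) (x : ℕ → Traffic N) (k : ℕ) : ℕ :=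
  if clearanceTime (frameTraffic T a x k) < T then 0 else packets (frameTraffic T a x k)

/-- Workload of a queue that is fed by `overflow` and serves one unit per frame. -/
def workload (T : ℕ) (a : ℕ → ℕ) (x : ℕ → Traffic N) : ℕ → ℕ
  | 0 => 0
  | k + 1 => workload T a x k + overflow T a x k - 1

open Classical in
-- One rejected coflow already forces the traffic of the frame to have clearance time at least `T`,
-- and then `overflow` counts every packet of the frame.
lemma sum_packets_nonconforming_le (hT : 0 < T) (ha : Monotone a) (k : ℕ) :
    ∑ m ∈ Finset.Ico (a (k * T)) (a ((k + 1) * T)) with IsNonconforming T a x m, packets (x m) ≤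
      overflow T a x k := by
  rw [overflow]
  split_ifs with h
  · rw [Finset.filter_eq_empty_iff.2 fun m hm hn => ?_, Finset.sum_empty]
    exact absurd (hn.le_clearanceTime_frameTraffic_and_ne_zero ha hT (Finset.mem_Ico.1 hm)).1
      (not_le.2 h)
  · rw [frameTraffic, packets_sum]
    exact Finset.sum_le_sum_of_subset (Finset.filter_subset _ _)

open Classical in
lemma fifoFree_le_add_sum (hT : 0 < T) (ha : Monotone a) {k c n : ℕ}
    (hc : fifoFree T a x (a (k * T)) ≤ c) (hkc : k + 1 ≤ c) (h1 : a (k * T) ≤ n)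
    (h2 : n ≤ a ((k + 1) * T)) : fifoFree T a x n ≤
      c + ∑ m ∈ Finset.Ico (a (k * T)) n with IsNonconforming T a x m, packets (x m) := by
  induction n, h1 using Nat.le_induction with
  | base => simpa using hc
  | succ n hn ih =>
    have ih := ih (Nat.le_of_succ_le h2)
    rw [← Finset.insert_Ico_right_eq_Ico_add_one hn, Finset.filter_insert, fifoFree]
    split_ifs with h
    · rw [Finset.sum_insert (by simp), InFrame.arrivalSlot_div hT ha ⟨hn, h2⟩]
      have h3 := clearanceTime_le_packets (x n)
      have h4 := max_le (show k + 1 ≤ c + ∑ m ∈ Finset.Ico (a (k * T)) n with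
        IsNonconforming T a x m, packets (x m) by omega) ih
      omega
    · exact ih

open Classical in
-- Passing to the next frame raises `k + 1` by one, which pays for the unit subtracted in
-- `workload`. When that subtraction truncates, the queue is empty and the bound is the first frame
-- in which a new coflow could be served.
lemma fifoFree_le_workload (hT : 0 < T) (ha : Monotone a) (ha0 : a 0 = 0) (k : ℕ) :
    fifoFree T a x (a (k * T)) ≤ k + 1 + workload T a x k := by
  induction k with
  | zero => simp [ha0, fifoFree]
  | succ k ih =>
    have h1 := fifoFree_le_add_sum hT ha ih (by omega)
      (ha (Nat.mul_le_mul_right T k.le_succ)) le_rfl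
    have h2 := sum_packets_nonconforming_le (x := x) hT ha k
    rw [workload]
    simp only [Nat.succ_eq_add_one] at h1
    omega

open Classical in
lemma IsNonconforming.fifo_end_le (hT : 0 < T) (ha : Monotone a) (ha0 : a 0 = 0) {k n : ℕ}
    (hn : IsNonconforming T a x n) (hk : InFrame T a k n) :
    fifoStart T a x n + clearanceTime (x n) ≤
      k + 1 + workload T a x k + overflow T a x k := by
  rw [← hn.fifoFree_succ]
  refine (fifoFree_le_add_sum hT ha (fifoFree_le_workload hT ha ha0 k) (by omega)
    (hk.1.trans n.le_succ) hk.2).trans (Nat.add_le_add_left ?_ _)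
  refine le_trans ?_ (sum_packets_nonconforming_le hT ha k)
  exact Finset.sum_le_sum_of_subset
    (Finset.filter_subset_filter _ (Finset.Ico_subset_Ico_right hk.2))

open Classical in
/-- Bound for the delay of a coflow that arrives in frame `k`. -/
noncomputable def delayBound (T : ℕ) (a : ℕ → ℕ) (x : ℕ → Traffic N) (k n : ℕ) : ℕ :=
  2 * T + if IsNonconforming T a x n then T * (workload T a x k + overflow T a x k + 1) else 0

/-- The term `2 * T` covers the rest of the arrival frame and the batch frame. A non-conforming
coflow is finished at the start of frame `k + 1 + workload + overflow`, at most `T * (workload +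
overflow + 1)` slots after the start of frame `k`. -/
lemma le_sum_range_cab (hG : IsOptimalClearance G) (hT : 0 < T) (ha : Monotone a) (ha0 : a 0 = 0)
    {k n : ℕ} (hk : InFrame T a k n) {t : ℕ} (ht : arrivalSlot a n + delayBound T a x k n ≤ t) :
    x n ≤ ∑ s ∈ Finset.range t, cab G T a x s n := by
  have hs := hk.le_arrivalSlot hT ha
  rw [delayBound] at ht
  split_ifs at ht with hn
  · rw [sum_range_cab_of_isNonconforming hT ha hn, min_eq_right, (hG (x n)).2]
    have h1 := hn.fifo_end_le hT ha ha0 hk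
    have h2 : k + 1 + workload T a x k + overflow T a x k ≤ t / T := by
      rw [Nat.le_div_iff_mul_le hT]
      have : (k + 1 + workload T a x k + overflow T a x k) * T =
        k * T + T * (workload T a x k + overflow T a x k + 1) := by ring
      omega
    omega
  · have hc : n ∈ conforming T a x k := by
      by_contra hc
      exact hn ⟨k, hk.1, hk.2, hc⟩
    have hlt : clearanceTime (∑ m ∈ conforming T a x k, x m) ≤ T - 1 :=
      Nat.le_pred_of_lt (clearanceTime_greedySelect_lt hT x _ _)
    rw [sum_range_cab_of_mem_conforming hT ha hc, min_eq_right,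
      sum_range_batchService_eq hG hc hlt]
    have : (k + 1) * T = k * T + T := by ring
    omega

lemma delay_cab_le (hG : IsOptimalClearance G) (hT : 0 < T) (ha : Monotone a) (ha0 : a 0 = 0)
    {n K : ℕ} (hn : n < a (K * T)) :
    delay a x (cab G T a x) n ≤ (delayBound T a x (arrivalSlot a n / T) n : ℕ) := by
  obtain ⟨k, -, hk⟩ := exists_inFrame ha0 hn
  rw [hk.arrivalSlot_div hT ha]
  exact iInf₂_le (delayBound T a x k n) (le_sum_range_cab hG hT ha ha0 hk le_rfl)

open Classical in
-- All non-conforming coflows of a frame share one excess bound, and their total weight is at most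
-- `overflow`. Weight `1` yields the sum of delays, weight `packets` the sum of backlogs. The
-- condition `a (k * T) < n` discards the frames that contain none of the first `n` coflows and,
-- being known at the start of the frame, keeps the cost of the other frames tractable.
lemma sum_mul_delayBound_le (hT : 0 < T) (ha : Monotone a) (ha0 : a 0 = 0) {n K : ℕ}
    (hn : n ≤ a (K * T)) {w : ℕ → ℕ} (hw : ∀ m, IsNonconforming T a x m → w m ≤ packets (x m)) :
    ∑ m ∈ Finset.range n, w m * delayBound T a x (arrivalSlot a m / T) m ≤
      2 * T * ∑ m ∈ Finset.range n, w m +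
        T * ∑ k ∈ Finset.range K, if a (k * T) < n then
          overflow T a x k * (workload T a x k + overflow T a x k + 1) else 0 := by
  have hsplit : ∀ m ∈ Finset.range n, w m * delayBound T a x (arrivalSlot a m / T) m ≤
      2 * T * w m + ∑ k ∈ Finset.range K, if a (k * T) < n then
        (if InFrame T a k m ∧ IsNonconforming T a x m then
          packets (x m) * (T * (workload T a x k + overflow T a x k + 1)) else 0) else 0 := by
    intro m hm
    have hmn := Finset.mem_range.1 hm
    obtain ⟨k, hk, hf⟩ := exists_inFrame ha0 (hmn.trans_le hn)
    rw [hf.arrivalSlot_div hT ha, delayBound, mul_add, mul_comm (w m)]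
    refine Nat.add_le_add_left ?_ _
    refine le_trans ?_ (Finset.single_le_sum (fun _ _ => Nat.zero_le _) (Finset.mem_range.2 hk))
    rw [if_pos (hf.1.trans_lt hmn)]
    by_cases hnc : IsNonconforming T a x m
    · rw [if_pos hnc, if_pos ⟨hf, hnc⟩]
      exact Nat.mul_le_mul_right _ (hw m hnc)
    · simp [hnc]
  refine (Finset.sum_le_sum hsplit).trans ?_
  rw [Finset.sum_add_distrib, Finset.sum_comm, Finset.mul_sum, Finset.mul_sum]
  refine Nat.add_le_add_left (Finset.sum_le_sum fun k _ => ?_) _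
  split_ifs with h
  · rw [← Finset.sum_filter, ← Finset.sum_mul, mul_left_comm]
    refine Nat.mul_le_mul_left _ (Nat.mul_le_mul_right _
      (le_trans ?_ (sum_packets_nonconforming_le hT ha k)))
    refine Finset.sum_le_sum_of_subset fun m hm => ?_
    obtain ⟨-, hm1, hm2⟩ := Finset.mem_filter.1 hm
    exact Finset.mem_filter.2 ⟨Finset.mem_Ico.2 hm1, hm2⟩
  · simp

lemma sum_delay_cab_le (hG : IsOptimalClearance G) (hT : 0 < T) (ha : Monotone a) (ha0 : a 0 = 0)
    {n K : ℕ} (hn : n ≤ a (K * T)) :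
    ∑ m ∈ Finset.range n, delay a x (cab G T a x) m ≤
      ((2 * T * n + T * ∑ k ∈ Finset.range K, if a (k * T) < n then
          overflow T a x k * (workload T a x k + overflow T a x k + 1) else 0 : ℕ) : ℝ≥0∞) := by
  have h := sum_mul_delayBound_le (x := x) hT ha ha0 hn (w := fun _ => 1) fun m hm => by
    obtain ⟨k, h1, h2, -⟩ := id hm
    have := (hm.le_clearanceTime_frameTraffic_and_ne_zero ha hT ⟨h1, h2⟩).2
    exact Nat.one_le_iff_ne_zero.2 fun h => this (packets_eq_zero_iff.1 h)
  simp only [one_mul, Finset.sum_const, Finset.card_range, smul_eq_mul, mul_one] at h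
  refine le_trans ?_ (Nat.cast_le.2 h)
  rw [Nat.cast_sum]
  exact Finset.sum_le_sum fun m hm =>
    delay_cab_le hG hT ha ha0 ((Finset.mem_range.1 hm).trans_le hn)

lemma sum_packets_eq_sum_frames (ha : Monotone a) (ha0 : a 0 = 0) (K : ℕ) :
    ∑ m ∈ Finset.range (a (K * T)), packets (x m) =
      ∑ k ∈ Finset.range K, packets (frameTraffic T a x k) := by
  induction K with
  | zero => simp [ha0]
  | succ K ih =>
    rw [Finset.sum_range_succ, ← ih, frameTraffic, packets_sum,
      Finset.sum_range_add_sum_Ico _ (ha (Nat.mul_le_mul_right T K.le_succ))]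

/-- As in Little's law, the sum over slots is exchanged with the sum over coflows: a coflow waits
only during the slots allowed by its delay bound, with at most all of its packets. -/
lemma sum_backlog_cab_le (hG : IsOptimalClearance G) (hT : 0 < T) (ha : Monotone a)
    (ha0 : a 0 = 0) {t K : ℕ} (ht : t ≤ K * T) :
    ∑ s ∈ Finset.range t, backlog a x (cab G T a x) s ≤
      2 * T * ∑ k ∈ Finset.range K, packets (frameTraffic T a x k) +
        T * ∑ k ∈ Finset.range K,
          overflow T a x k * (workload T a x k + overflow T a x k + 1) := by
  set D : ℕ → ℕ := fun m => delayBound T a x (arrivalSlot a m / T) m with hD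
  have hrem : ∀ s ∈ Finset.range t, backlog a x (cab G T a x) s ≤
      ∑ m ∈ Finset.range (a (K * T)),
        if s ∈ Finset.Ico (arrivalSlot a m) (arrivalSlot a m + D m) then packets (x m) else 0 := by
    intro s hs
    have hst := Finset.mem_range.1 hs
    have hsub : a s ≤ a (K * T) := ha (hst.le.trans ht)
    refine le_trans (Finset.sum_le_sum fun m hm => ?_)
      (Finset.sum_le_sum_of_subset (Finset.range_subset_range.2 hsub))
    have hms := Finset.mem_range.1 hm
    obtain ⟨k, -, hf⟩ := exists_inFrame ha0 (hms.trans_le hsub)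
    have hs0 : s ≠ 0 := by rintro rfl; simp [ha0] at hms
    have harr : arrivalSlot a m ≤ s := by
      have := arrivalSlot_le (a := a) (n := m) (t := s - 1)
        (by rwa [Nat.sub_add_cancel (Nat.one_le_iff_ne_zero.2 hs0)])
      omega
    split_ifs with hmem
    · exact Finset.sum_le_sum fun i _ => Finset.sum_le_sum fun j _ => Nat.sub_le _ _
    · have hle : arrivalSlot a m + delayBound T a x k m ≤ s := by
        simp only [hD, hf.arrivalSlot_div hT ha, Finset.mem_Ico] at hmem
        omega
      refine (Finset.sum_eq_zero fun i _ => Finset.sum_eq_zero fun j _ => ?_).le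
      have := le_sum_range_cab hG hT ha ha0 hf hle i j
      simp only [Finset.sum_apply] at this
      exact Nat.sub_eq_zero_of_le this
  refine (Finset.sum_le_sum hrem).trans ?_
  rw [Finset.sum_comm]
  have hcount : ∀ m ∈ Finset.range (a (K * T)), (∑ s ∈ Finset.range t,
      if s ∈ Finset.Ico (arrivalSlot a m) (arrivalSlot a m + D m) then packets (x m) else 0) ≤
      packets (x m) * D m := by
    intro m _
    rw [← Finset.sum_filter, Finset.sum_const, smul_eq_mul, mul_comm]
    refine Nat.mul_le_mul_left _ ?_
    refine (Finset.card_le_card (t := Finset.Ico (arrivalSlot a m) (arrivalSlot a m + D m))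
      fun s hs => (Finset.mem_filter.1 hs).2).trans ?_
    simp
  refine (Finset.sum_le_sum hcount).trans ((sum_mul_delayBound_le hT ha ha0 le_rfl
    fun m _ => le_rfl).trans ?_)
  rw [sum_packets_eq_sum_frames ha ha0]
  refine Nat.add_le_add_left (Nat.mul_le_mul_left _ (Finset.sum_le_sum fun k _ => ?_)) _
  split_ifs
  · exact le_rfl
  · exact Nat.zero_le _

end Cab

/-! ### Independence of the past and of the traffic of a frame -/

section Past

variable {Ω : Type u} {N T : ℕ} {A : ℝ≥0 → Ω → ℕ} {X : ℕ → Ω → Traffic N}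

/-- `F` is determined by what happens before frame `k`. -/
def IsPast {β : Type*} (T : ℕ) (A : ℝ≥0 → Ω → ℕ) (X : ℕ → Ω → Traffic N) (k : ℕ) (F : Ω → β) :
    Prop :=
  ∀ ω ω', (∀ j ≤ k, slotCount A ω (j * T) = slotCount A ω' (j * T)) →
    (∀ m < slotCount A ω (k * T), X m ω = X m ω') → F ω = F ω'

/-- For a fixed number `n` of earlier coflows, the past is a finite tuple in a countable space.
Functions of it are automatically measurable, and independence of deterministic blocks becomes
applicable. -/
lemma IsPast.exists_factorization {k : ℕ} {F : Ω → ℝ≥0∞} (hF : IsPast T A X k F) :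
    ∃ φ : (n : ℕ) → (Fin (k + 1) → ℕ) × (Fin n → Traffic N) → ℝ≥0∞, ∀ ω n,
      φ n ((fun j => slotCount A ω (j * T)), fun m => X m ω) =
        if slotCount A ω (k * T) = n then F ω else 0 := by
  classical
  let U : Ω → Fin (k + 1) → ℕ := fun ω j => slotCount A ω (j * T)
  let ι : (n : ℕ) → {ω // slotCount A ω (k * T) = n} → (Fin (k + 1) → ℕ) × (Fin n → Traffic N) :=
    fun n ω => (U ω, fun m => X m ω)
  have hfac : ∀ n, Function.FactorsThrough (fun ω : {ω // slotCount A ω (k * T) = n} => F ω)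
      (ι n) := by
    rintro n ⟨ω, hω⟩ ⟨ω', hω'⟩ heq
    obtain ⟨h1, h2⟩ := Prod.ext_iff.1 heq
    refine hF ω ω' (fun j hj => congr_fun h1 ⟨j, Nat.lt_succ_of_le hj⟩) fun m hm => ?_
    exact congr_fun h2 ⟨m, hω ▸ hm⟩
  refine ⟨fun n y => if y.1 (Fin.last k) = n then
    Function.extend (ι n) (fun ω => F ω) 0 y else 0, fun ω n => ?_⟩
  by_cases hω : slotCount A ω (k * T) = n
  · simp only [Fin.val_last, hω, if_true]
    exact (hfac n).extend_apply 0 ⟨ω, hω⟩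
  · simp only [Fin.val_last, hω, if_false]

end Past

section Independence

variable {Ω : Type u} [MeasurableSpace Ω] {μ : Measure Ω}

/-- Here `U`, `P` are the counts and matrices of the past, `D`, `Q` those of the current frame.
Independence is given inside and between the pairs `(U, D)` and `(P, Q)`, so the joint law is a
fourfold product and Fubini regroups it as past against present. -/
lemma lintegral_mul_of_indepFun_prod [IsProbabilityMeasure μ] {α β γ δ : Type*}
    [MeasurableSpace α] [MeasurableSpace β]
    [MeasurableSpace γ] [MeasurableSpace δ] {U : Ω → α} {D : Ω → β} {P : Ω → γ} {Q : Ω → δ}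
    (hU : Measurable U) (hD : Measurable D) (hP : Measurable P) (hQ : Measurable Q)
    (hUD : IndepFun U D μ) (hPQ : IndepFun P Q μ)
    (h : IndepFun (fun ω => (U ω, D ω)) (fun ω => (P ω, Q ω)) μ)
    {φ : α × γ → ℝ≥0∞} (hφ : Measurable φ) {ψ : δ → ℝ≥0∞} (hψ : Measurable ψ)
    {χ : β → ℝ≥0∞} (hχ : Measurable χ) :
    ∫⁻ ω, φ (U ω, P ω) * (χ (D ω) * ψ (Q ω)) ∂μ =
      (∫⁻ ω, φ (U ω, P ω) ∂μ) * ((∫⁻ ω, χ (D ω) ∂μ) * ∫⁻ ω, ψ (Q ω) ∂μ) := by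
  have := Measure.isProbabilityMeasure_map (μ := μ) hU.aemeasurable
  have := Measure.isProbabilityMeasure_map (μ := μ) hD.aemeasurable
  have := Measure.isProbabilityMeasure_map (μ := μ) hP.aemeasurable
  have := Measure.isProbabilityMeasure_map (μ := μ) hQ.aemeasurable
  have hUP : IndepFun U P μ := h.comp measurable_fst measurable_fst
  have e1 : ∫⁻ ω, φ (U ω, P ω) ∂μ = ∫⁻ u, ∫⁻ p, φ (u, p) ∂(μ.map P) ∂(μ.map U) := by
    rw [← lintegral_prod _ hφ.aemeasurable,
      ← (indepFun_iff_map_prod_eq_prod_map_map hU.aemeasurable hP.aemeasurable).1 hUP,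
      lintegral_map hφ (hU.prodMk hP)]
  have hmap := (indepFun_iff_map_prod_eq_prod_map_map (hU.prodMk hD).aemeasurable
    (hP.prodMk hQ).aemeasurable).1 h
  rw [(indepFun_iff_map_prod_eq_prod_map_map hU.aemeasurable hD.aemeasurable).1 hUD,
    (indepFun_iff_map_prod_eq_prod_map_map hP.aemeasurable hQ.aemeasurable).1 hPQ] at hmap
  let Φ : (α × β) × (γ × δ) → ℝ≥0∞ := fun z => φ (z.1.1, z.2.1) * (χ z.1.2 * ψ z.2.2)
  have hΦ : Measurable Φ := by fun_prop
  have hinner : Measurable fun u => ∫⁻ p, φ (u, p) ∂(μ.map P) := hφ.lintegral_prod_right'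
  calc ∫⁻ ω, φ (U ω, P ω) * (χ (D ω) * ψ (Q ω)) ∂μ
      = ∫⁻ z, Φ z ∂(((μ.map U).prod (μ.map D)).prod ((μ.map P).prod (μ.map Q))) := by
        rw [← hmap, lintegral_map hΦ (by fun_prop)]
    _ = ∫⁻ u, ∫⁻ d, ∫⁻ p, ∫⁻ q, φ (u, p) * (χ d * ψ q) ∂(μ.map Q) ∂(μ.map P) ∂(μ.map D)
          ∂(μ.map U) := by
        rw [lintegral_prod _ hΦ.aemeasurable,
          lintegral_prod _ hΦ.lintegral_prod_right'.aemeasurable]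
        refine lintegral_congr fun u => lintegral_congr fun d => ?_
        rw [lintegral_prod _ (by fun_prop)]
    _ = (∫⁻ u, ∫⁻ p, φ (u, p) ∂(μ.map P) ∂(μ.map U)) *
          ((∫⁻ d, χ d ∂(μ.map D)) * ∫⁻ q, ψ q ∂(μ.map Q)) := by
        rw [← lintegral_mul_const _ hinner]
        refine lintegral_congr fun u => ?_
        rw [← lintegral_mul_const _ hχ, ← lintegral_const_mul _ (by fun_prop)]
        refine lintegral_congr fun d => ?_
        rw [← lintegral_const_mul _ hψ, ← lintegral_mul_const _ (by fun_prop)]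
        refine lintegral_congr fun p => ?_
        rw [lintegral_const_mul _ (by fun_prop)]
    _ = _ := by rw [e1, lintegral_map hχ hD, lintegral_map hψ hQ]

variable {N : ℕ} {lam : ℝ≥0} {ν : Fin N → Fin N → ProbabilityMeasure ℕ} {A : ℝ≥0 → Ω → ℕ}
  {X : ℕ → Ω → Traffic N} {T : ℕ}

lemma IsCoflowTraffic.slotCount_mono (h : IsCoflowTraffic μ lam ν A X) (ω : Ω) :
    Monotone (slotCount A ω) := fun _ _ hst => h.poisson.mono ω (Nat.cast_le.2 hst)

lemma IsCoflowTraffic.slotCount_zero (h : IsCoflowTraffic μ lam ν A X) (ω : Ω) :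
    slotCount A ω 0 = 0 := by simpa [slotCount] using h.poisson.zero ω

lemma IsCoflowTraffic.measurable_slotCount (h : IsCoflowTraffic μ lam ν A X) (t : ℕ) :
    Measurable fun ω => slotCount A ω t := h.poisson.measurable _

/-- The counts at frame boundaries are partial sums of the earlier increments. -/
lemma IsCoflowTraffic.indepFun_count_increment (h : IsCoflowTraffic μ lam ν A X) (T k : ℕ) :
    IndepFun (fun ω (j : Fin (k + 1)) => slotCount A ω (j * T))
      (fun ω => slotCount A ω ((k + 1) * T) - slotCount A ω (k * T)) μ := by
  have hinc := h.poisson.indep.nat (t := fun i : ℕ => ((i * T : ℕ) : ℝ≥0))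
    (fun i j hij => Nat.cast_le.2 (Nat.mul_le_mul_right T hij))
  have hind := hinc.indepFun_finset (Finset.range k) {k} (by simp)
    fun i => (h.poisson.measurable _).sub (h.poisson.measurable _)
  let Φ : (Finset.range k → ℕ) → Fin (k + 1) → ℕ := fun y j =>
    ∑ i : Fin j, y ⟨i, Finset.mem_range.2 (i.2.trans_le (Nat.lt_succ_iff.1 j.2))⟩
  let Ψ : (({k} : Finset ℕ) → ℕ) → ℕ := fun y => y ⟨k, by simp⟩
  have := hind.comp (φ := Φ) (ψ := Ψ) (measurable_of_countable _) (measurable_of_countable _)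
  convert this using 1
  · funext ω j
    simp only [Function.comp_apply, Φ]
    rw [Finset.sum_fin_eq_sum_range, Finset.sum_congr rfl (g := fun i =>
      slotCount A ω ((i + 1) * T) - slotCount A ω (i * T)) fun i hi => by
        rw [dif_pos (Finset.mem_range.1 hi)]; rfl,
      Finset.sum_range_tsub fun i j hij => h.slotCount_mono ω (Nat.mul_le_mul_right T hij)]
    simp [h.slotCount_zero]
  · rfl

lemma IsCoflowTraffic.indepFun_blocks (h : IsCoflowTraffic μ lam ν A X) (n d : ℕ) :
    IndepFun (fun ω (m : Fin n) => X m ω) (fun ω (m : Fin d) => X (n + m) ω) μ := by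
  have hmeas : ∀ p : ℕ × Fin N × Fin N, Measurable fun ω => X p.1 ω p.2.1 p.2.2 := fun p =>
    (measurable_pi_apply p.2.2).comp ((measurable_pi_apply p.2.1).comp (h.measurable p.1))
  have hind := h.indep.indepFun_finset (Finset.range n ×ˢ Finset.univ)
    (Finset.Ico n (n + d) ×ˢ Finset.univ) (by
      rw [Finset.disjoint_left]
      rintro ⟨m, q⟩ hm hm'
      simp only [Finset.mem_product, Finset.mem_range, Finset.mem_Ico] at hm hm'
      omega) hmeas
  let Φ : ((Finset.range n ×ˢ (Finset.univ : Finset (Fin N × Fin N)) : Finset _) → ℕ) →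
      Fin n → Traffic N := fun y m i j => y ⟨(m, i, j), by simp⟩
  let Ψ : ((Finset.Ico n (n + d) ×ˢ (Finset.univ : Finset (Fin N × Fin N)) : Finset _) → ℕ) →
      Fin d → Traffic N := fun y m i j => y ⟨(n + m, i, j), by simp⟩
  exact hind.comp (φ := Φ) (ψ := Ψ) (measurable_of_countable _) (measurable_of_countable _)

lemma IsCoflowTraffic.indepFun_arrivals_blocks (h : IsCoflowTraffic μ lam ν A X) (T k n d : ℕ) :
    IndepFun (fun ω => ((fun j : Fin (k + 1) => slotCount A ω (j * T)),
        slotCount A ω ((k + 1) * T) - slotCount A ω (k * T)))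
      (fun ω => ((fun m : Fin n => X m ω), (fun m : Fin d => X (n + m) ω))) μ := by
  have hφ : Measurable fun y : ℝ≥0 → ℕ => ((fun j : Fin (k + 1) => y ((j * T : ℕ) : ℝ≥0)),
      y (((k + 1) * T : ℕ) : ℝ≥0) - y ((k * T : ℕ) : ℝ≥0)) := by fun_prop
  have hψ : Measurable fun y : ℕ → Traffic N =>
      ((fun m : Fin n => y m), (fun m : Fin d => y (n + m))) := by fun_prop
  exact h.indepArrivals.comp hφ hψ

lemma tsum_ite_eq_apply {f : ℕ → ℝ≥0∞} (b : ℕ) : ∑' n, (if b = n then f n else 0) = f b := by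
  rw [tsum_eq_single b fun n hn => if_neg hn.symm, if_pos rfl]

lemma IsCoflowTraffic.measurable_of_isPast (h : IsCoflowTraffic μ lam ν A X) {k : ℕ}
    {F : Ω → ℝ≥0∞} (hF : IsPast T A X k F) : Measurable F := by
  obtain ⟨φ, hφ⟩ := hF.exists_factorization
  have hmU : Measurable fun ω (j : Fin (k + 1)) => slotCount A ω (j * T) :=
    measurable_pi_lambda _ fun j => h.measurable_slotCount _
  have hF' : F = fun ω => ∑' n, φ n ((fun j => slotCount A ω (j * T)), fun m => X m ω) := by
    funext ω
    simp only [hφ, tsum_ite_eq_apply (f := fun _ => F ω)]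
  rw [hF']
  exact Measurable.tsum fun n => (measurable_of_countable (φ n)).comp
    (hmU.prodMk (measurable_pi_lambda _ fun m => h.measurable _))

/-- What happens before frame `k` is independent of the arrivals in frame `k`. -/
lemma IsCoflowTraffic.lintegral_past_mul [IsProbabilityMeasure μ]
    (h : IsCoflowTraffic μ lam ν A X) {k : ℕ}
    {F : Ω → ℝ≥0∞} (hF : IsPast T A X k F) {g : (d : ℕ) → (Fin d → Traffic N) → ℝ≥0∞}
    {γ : ℕ → ℝ≥0∞} (hg : ∀ n d, ∫⁻ ω, g d (fun m => X (n + m) ω) ∂μ = γ d) :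
    ∫⁻ ω, F ω * g (slotCount A ω ((k + 1) * T) - slotCount A ω (k * T))
        (fun m => X (slotCount A ω (k * T) + m) ω) ∂μ =
      (∫⁻ ω, F ω ∂μ) * ∑' d, poissonMeasure (lam * T) {d} * γ d := by
  obtain ⟨φ, hφ⟩ := hF.exists_factorization
  set U : Ω → Fin (k + 1) → ℕ := fun ω j => slotCount A ω (j * T)
  set D : Ω → ℕ := fun ω => slotCount A ω ((k + 1) * T) - slotCount A ω (k * T) with hDdef
  have hmU : Measurable U := measurable_pi_lambda _ fun j => h.measurable_slotCount _
  have hmD : Measurable D := (h.measurable_slotCount _).sub (h.measurable_slotCount _)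
  have hmP : ∀ n, Measurable fun ω (m : Fin n) => X m ω :=
    fun n => measurable_pi_lambda _ fun m => h.measurable _
  have hmQ : ∀ n d, Measurable fun ω (m : Fin d) => X (n + m) ω :=
    fun n d => measurable_pi_lambda _ fun m => h.measurable _
  have hmφ : ∀ n, Measurable fun ω => φ n (U ω, fun m => X m ω) := fun n =>
    (measurable_of_countable (φ n)).comp (hmU.prodMk (hmP n))
  have hmχ : ∀ d : ℕ, Measurable fun b : ℕ => if b = d then (1 : ℝ≥0∞) else 0 :=
    fun d => measurable_of_countable _
  have hmg : ∀ n d, Measurable fun ω => g d (fun m => X (n + m) ω) := fun n d =>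
    (measurable_of_countable (g d)).comp (hmQ n d)
  have hlaw : ∀ d, ∫⁻ ω, (if D ω = d then (1 : ℝ≥0∞) else 0) ∂μ =
      poissonMeasure (lam * T) {d} := by
    intro d
    have hl := (h.poisson.increments (((k * T : ℕ)) : ℝ≥0) (((k + 1) * T : ℕ) : ℝ≥0)
      (Nat.cast_le.2 (Nat.mul_le_mul_right T k.le_succ))).map_eq
    have ht : (((k + 1) * T : ℕ) : ℝ≥0) - ((k * T : ℕ) : ℝ≥0) = T := by
      rw [add_mul, one_mul, Nat.cast_add, add_tsub_cancel_left]
    rw [ht] at hl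
    change μ.map D = _ at hl
    rw [← hl, Measure.map_apply hmD (measurableSet_singleton d),
      ← lintegral_indicator_one (hmD (measurableSet_singleton d))]
    refine lintegral_congr fun ω => ?_
    by_cases hd : D ω = d <;> simp [hd]
  -- Splitting by the number `n` of earlier coflows and the number `d` of arrivals in the frame
  -- replaces the random block of coflows by a deterministic one.
  have hexpand : ∀ ω, F ω * g (D ω) (fun m => X (slotCount A ω (k * T) + m) ω) =
      ∑' n, ∑' d, φ n (U ω, fun m => X m ω) *
        ((if D ω = d then 1 else 0) * g d (fun m => X (n + m) ω)) := by
    intro ω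
    have h1 : ∀ n, ∑' d, φ n (U ω, fun m => X m ω) *
        ((if D ω = d then 1 else 0) * g d (fun m => X (n + m) ω)) =
        if slotCount A ω (k * T) = n then F ω * g (D ω) (fun m => X (n + m) ω) else 0 := by
      intro n
      rw [ENNReal.tsum_mul_left, hφ]
      simp only [ite_mul, one_mul, zero_mul]
      rw [tsum_ite_eq_apply (f := fun d => g d fun m => X (n + m) ω)]
    simp only [h1]
    rw [tsum_ite_eq_apply (f := fun n => F ω * g (D ω) (fun m => X (n + m) ω))]
  have hterm : ∀ n d, ∫⁻ ω, φ n (U ω, fun m => X m ω) *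
        ((if D ω = d then 1 else 0) * g d (fun m => X (n + m) ω)) ∂μ =
      (∫⁻ ω, φ n (U ω, fun m => X m ω) ∂μ) * (poissonMeasure (lam * T) {d} * γ d) := by
    intro n d
    rw [lintegral_mul_of_indepFun_prod (φ := φ n) (χ := fun b => if b = d then 1 else 0) (ψ := g d)
      hmU hmD (hmP n) (hmQ n d) (h.indepFun_count_increment T k) (h.indepFun_blocks n d)
      (h.indepFun_arrivals_blocks T k n d) (measurable_of_countable _) (measurable_of_countable _)
      (hmχ d), hlaw, hg]
  have hFsum : ∫⁻ ω, F ω ∂μ = ∑' n, ∫⁻ ω, φ n (U ω, fun m => X m ω) ∂μ := by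
    rw [← lintegral_tsum fun n => (hmφ n).aemeasurable]
    refine lintegral_congr fun ω => ?_
    simp only [hφ, U, tsum_ite_eq_apply (f := fun _ => F ω)]
  rw [lintegral_congr hexpand, lintegral_tsum fun n => ?_, hFsum, ← ENNReal.tsum_mul_right]
  · refine tsum_congr fun n => ?_
    rw [lintegral_tsum fun d => ?_, ← ENNReal.tsum_mul_left]
    · exact tsum_congr fun d => hterm n d
    · exact ((hmφ n).mul (((hmχ d).comp hmD).mul (hmg n d))).aemeasurable
  · exact (Measurable.tsum fun d =>
      (hmφ n).mul (((hmχ d).comp hmD).mul (hmg n d))).aemeasurable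

end Independence

/-! ### Exponential moments of the traffic of a frame -/

section Ports

variable {N : ℕ}

/-- The entries of a traffic matrix that belong to a port: input ports are on the left, output
ports on the right. -/
def portEntry : Fin N ⊕ Fin N → Fin N → Fin N × Fin N
  | .inl i, l => (i, l)
  | .inr j, l => (l, j)

lemma portEntry_injective (p : Fin N ⊕ Fin N) : Function.Injective (portEntry p) := by
  intro l m h
  rcases p with i | j <;> simpa [portEntry] using h

/-- Number of packets that a traffic matrix brings to a port. -/
def portSum (p : Fin N ⊕ Fin N) (B : Traffic N) : ℕ :=
  ∑ l, B (portEntry p l).1 (portEntry p l).2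

lemma packets_eq_sum_portSum (B : Traffic N) : packets B = ∑ i, portSum (.inl i) B := rfl

lemma exists_le_portSum {T : ℕ} (hT : 0 < T) {B : Traffic N} (h : T ≤ clearanceTime B) :
    ∃ p, T ≤ portSum p B := by
  rcases le_max_iff.1 h with h | h
  · obtain ⟨i, -, hi⟩ := (Finset.le_sup_iff hT).1 h
    exact ⟨.inl i, hi⟩
  · obtain ⟨j, -, hj⟩ := (Finset.le_sup_iff hT).1 h
    exact ⟨.inr j, hj⟩

/-- Moment generating function of the number of packets that a coflow brings to a port. -/
noncomputable def portMgf (ν : Fin N → Fin N → ProbabilityMeasure ℕ) (s : ℝ)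
    (p : Fin N ⊕ Fin N) : ℝ≥0∞ :=
  ∫⁻ y : Fin N → ℕ, ENNReal.ofReal (Real.exp (s * ∑ l, (y l : ℝ)))
    ∂(Measure.pi fun l => (ν (portEntry p l).1 (portEntry p l).2 : Measure ℕ))

/-- From `exp u ≤ 1 + u + u ^ 2 * exp u` with `u = s * y`: one half of the exponent `θ` absorbs `exp
(s * y)`, the other half absorbs `y ^ 2`. -/
lemma exp_le_one_add_add {θ s y : ℝ} (hθ : 0 < θ) (hs : 0 ≤ s) (hsθ : s ≤ θ / 2) (hy : 0 ≤ y) :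
    Real.exp (s * y) ≤ 1 + s * y + s ^ 2 * (16 / θ ^ 2) * Real.exp (θ * y) := by
  have hu : 0 ≤ s * y := mul_nonneg hs hy
  have h1 : Real.exp (s * y) ≤ 1 + s * y + (s * y) ^ 2 * Real.exp (s * y) := by
    have h2 : Real.exp (s * y) - 1 ≤ s * y * Real.exp (s * y) := by
      have h3 := Real.add_one_le_exp (-(s * y))
      have h4 : Real.exp (-(s * y)) * Real.exp (s * y) = 1 := by
        rw [← Real.exp_add, neg_add_cancel, Real.exp_zero]
      nlinarith [Real.exp_pos (s * y)]
    nlinarith [mul_le_mul_of_nonneg_left h2 hu]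
  have h5 : Real.exp (s * y) ≤ Real.exp (θ / 2 * y) :=
    Real.exp_le_exp.2 (mul_le_mul_of_nonneg_right hsθ hy)
  have h6 : y ^ 2 ≤ 16 / θ ^ 2 * Real.exp (θ / 2 * y) := by
    have h7 : θ / 4 * y ≤ Real.exp (θ / 4 * y) := by
      linarith [Real.add_one_le_exp (θ / 4 * y)]
    have h8 : Real.exp (θ / 2 * y) = Real.exp (θ / 4 * y) ^ 2 := by
      rw [← Real.exp_nat_mul]; congr 1; push_cast; ring
    have h9 := pow_le_pow_left₀ (by positivity) h7 2
    rw [h8, div_mul_eq_mul_div, le_div_iff₀ (by positivity)]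
    nlinarith
  have h10 : Real.exp (θ * y) = Real.exp (θ / 2 * y) * Real.exp (θ / 2 * y) := by
    rw [← Real.exp_add]; congr 1; ring
  have h11 : y ^ 2 * Real.exp (s * y) ≤ 16 / θ ^ 2 * Real.exp (θ * y) := by
    rw [h10, ← mul_assoc]
    exact mul_le_mul h6 h5 (Real.exp_pos _).le (by positivity)
  calc Real.exp (s * y) ≤ 1 + s * y + (s * y) ^ 2 * Real.exp (s * y) := h1
    _ = 1 + s * y + s ^ 2 * (y ^ 2 * Real.exp (s * y)) := by ring
    _ ≤ 1 + s * y + s ^ 2 * (16 / θ ^ 2 * Real.exp (θ * y)) := by gcongr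
    _ = _ := by ring

lemma sum_lintegral_le_meanLoad (ν : Fin N → Fin N → ProbabilityMeasure ℕ) (p : Fin N ⊕ Fin N) :
    ∑ l, ∫⁻ y, (y : ℝ≥0∞) ∂(ν (portEntry p l).1 (portEntry p l).2 : Measure ℕ) ≤ meanLoad ν := by
  rcases p with i | j
  · exact le_max_of_le_left
      (le_iSup (fun i => ∑ j, ∫⁻ y, (y : ℝ≥0∞) ∂(ν i j : Measure ℕ)) i)
  · exact le_max_of_le_right
      (le_iSup (fun j => ∑ i, ∫⁻ y, (y : ℝ≥0∞) ∂(ν i j : Measure ℕ)) j)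

/-- The load enters at first order in `s`, while the tail constant `C` enters only at second order;
a small `s` therefore preserves the gap `1 - rho`, uniformly in `N`. -/
lemma portMgf_le {ν : Fin N → Fin N → ProbabilityMeasure ℕ} {p : Fin N ⊕ Fin N} {θ s β : ℝ}
    {C : ℝ≥0} (hθ : 0 < θ) (hs : 0 ≤ s) (hsθ : s ≤ θ / 2) (hβ : 0 ≤ β)
    (hC : portMgf ν θ p ≤ C) (hload : meanLoad ν ≤ ENNReal.ofReal β) :
    portMgf ν s p ≤ ENNReal.ofReal (1 + (s * β + s ^ 2 * (16 / θ ^ 2) * C)) := by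
  set π := Measure.pi fun l => (ν (portEntry p l).1 (portEntry p l).2 : Measure ℕ) with hπ
  have hsum : ∫⁻ y : Fin N → ℕ, ((∑ l, y l : ℕ) : ℝ≥0∞) ∂π ≤ ENNReal.ofReal β := by
    refine le_trans (le_of_eq ?_) ((sum_lintegral_le_meanLoad ν p).trans hload)
    simp only [Nat.cast_sum]
    rw [lintegral_finsetSum _ fun l _ => measurable_of_countable _]
    refine Finset.sum_congr rfl fun l _ => ?_
    exact (measurePreserving_eval (fun l => (ν (portEntry p l).1 (portEntry p l).2 : Measure ℕ))
      l).lintegral_comp (f := fun y : ℕ => (y : ℝ≥0∞)) (measurable_of_countable _)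
  calc portMgf ν s p
      ≤ ∫⁻ y : Fin N → ℕ, (1 + ENNReal.ofReal s * ((∑ l, y l : ℕ) : ℝ≥0∞) +
          ENNReal.ofReal (s ^ 2 * (16 / θ ^ 2)) *
            ENNReal.ofReal (Real.exp (θ * ∑ l, (y l : ℝ)))) ∂π := by
        refine lintegral_mono fun y => ?_
        have h0 : (0 : ℝ) ≤ ∑ l, (y l : ℝ) := Finset.sum_nonneg fun l _ => Nat.cast_nonneg _
        refine (ENNReal.ofReal_le_ofReal (exp_le_one_add_add hθ hs hsθ h0)).trans_eq ?_
        rw [ENNReal.ofReal_add (by positivity) (by positivity),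
          ENNReal.ofReal_add zero_le_one (by positivity), ENNReal.ofReal_one,
          ENNReal.ofReal_mul hs, ENNReal.ofReal_mul (by positivity), ← Nat.cast_sum,
          ENNReal.ofReal_natCast]
    _ = 1 + ENNReal.ofReal s * ∫⁻ y : Fin N → ℕ, ((∑ l, y l : ℕ) : ℝ≥0∞) ∂π +
          ENNReal.ofReal (s ^ 2 * (16 / θ ^ 2)) * portMgf ν θ p := by
        rw [lintegral_add_left (measurable_of_countable _),
          lintegral_add_left (measurable_of_countable _), lintegral_one, measure_univ,
          lintegral_const_mul _ (measurable_of_countable _),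
          lintegral_const_mul _ (measurable_of_countable _), portMgf]
    _ ≤ 1 + ENNReal.ofReal s * ENNReal.ofReal β +
          ENNReal.ofReal (s ^ 2 * (16 / θ ^ 2)) * C := by gcongr
    _ = _ := by
        rw [← ENNReal.ofReal_coe_nnreal, ← ENNReal.ofReal_mul hs,
          ← ENNReal.ofReal_mul (by positivity), ← ENNReal.ofReal_one,
          ← ENNReal.ofReal_add zero_le_one (by positivity),
          ← ENNReal.ofReal_add (by positivity) (by positivity), add_assoc]

lemma tsum_poissonMeasure_mul_pow_le (r : ℝ≥0) {y : ℝ≥0∞} {u : ℝ} (hu : 0 ≤ u)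
    (hy : y ≤ ENNReal.ofReal (1 + u)) :
    ∑' d, poissonMeasure r {d} * y ^ d ≤ ENNReal.ofReal (Real.exp (r * u)) := by
  have hterm : ∀ d : ℕ, poissonMeasure r {d} * y ^ d ≤
      ENNReal.ofReal (Real.exp (-r) * ((r * (1 + u)) ^ d / d.factorial)) := by
    intro d
    rw [poissonMeasure_singleton]
    refine (mul_le_mul_right (pow_le_pow_left₀ zero_le hy d) _).trans_eq ?_
    rw [← ENNReal.ofReal_pow (by positivity), ← ENNReal.ofReal_mul (by positivity), mul_pow]
    congr 1
    ring
  have hsum : HasSum (fun d : ℕ => Real.exp (-r) * ((r * (1 + u)) ^ d / d.factorial))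
      (Real.exp (r * u)) := by
    have h := (NormedSpace.expSeries_div_hasSum_exp (r * (1 + u) : ℝ)).mul_left (Real.exp (-r))
    rw [← Real.exp_eq_exp_ℝ, ← Real.exp_add] at h
    rwa [show -(r : ℝ) + r * (1 + u) = r * u by ring] at h
  refine (ENNReal.tsum_le_tsum hterm).trans_eq ?_
  rw [← ENNReal.ofReal_tsum_of_nonneg (fun d => by positivity) hsum.summable, hsum.tsum_eq]

end Ports

section Moments

variable {Ω : Type u} [MeasurableSpace Ω] {μ : Measure Ω} {N T : ℕ}
  {lam : ℝ≥0} {ν : Fin N → Fin N → ProbabilityMeasure ℕ} {A : ℝ≥0 → Ω → ℕ}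
  {X : ℕ → Ω → Traffic N}

lemma IsCoflowTraffic.lintegral_exp_portSum (h : IsCoflowTraffic μ lam ν A X) (s : ℝ)
    (p : Fin N ⊕ Fin N) (n : ℕ) :
    ∫⁻ ω, ENNReal.ofReal (Real.exp (s * portSum p (X n ω))) ∂μ = portMgf ν s p := by
  have hinj : Function.Injective fun l : Fin N => (n, portEntry p l) := fun l m hlm =>
    portEntry_injective p (Prod.ext_iff.1 hlm).2
  have hlaw := (h.indep.precomp hinj).hasLaw_pi fun l => h.law n (portEntry p l).1 (portEntry p l).2
  rw [portMgf, ← hlaw.lintegral_comp (measurable_of_countable _).aemeasurable]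
  simp only [portSum, Nat.cast_sum]

lemma IsCoflowTraffic.lintegral_exp_portSum_block [IsProbabilityMeasure μ]
    (h : IsCoflowTraffic μ lam ν A X) (s : ℝ)
    (p : Fin N ⊕ Fin N) (n d : ℕ) :
    ∫⁻ ω, ENNReal.ofReal (Real.exp (s * portSum p (∑ m : Fin d, X (n + m) ω))) ∂μ =
      portMgf ν s p ^ d := by
  induction d with
  | zero => simp [portSum]
  | succ d ih =>
    have hind := (h.indepFun_blocks (n + d) 1).comp
      (φ := fun y : Fin (n + d) → Traffic N => ENNReal.ofReal (Real.exp (s * portSum p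
        (∑ m : Fin d, y (Fin.natAdd n m)))))
      (ψ := fun y : Fin 1 → Traffic N => ENNReal.ofReal (Real.exp (s * portSum p (y 0))))
      (measurable_of_countable _) (measurable_of_countable _)
    have hm1 : Measurable fun ω => ENNReal.ofReal (Real.exp (s * portSum p
        (∑ m : Fin d, X (n + m) ω))) :=
      (measurable_of_countable fun y : Fin d → Traffic N => ENNReal.ofReal (Real.exp
        (s * portSum p (∑ m : Fin d, y m)))).comp (measurable_pi_lambda _ fun m => h.measurable _)
    have hm2 : Measurable fun ω => ENNReal.ofReal (Real.exp (s * portSum p (X (n + d) ω))) :=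
      (measurable_of_countable fun y : Traffic N => ENNReal.ofReal (Real.exp
        (s * portSum p y))).comp (h.measurable _)
    have hmul := lintegral_mul_eq_lintegral_mul_lintegral_of_indepFun hm1 hm2 hind
    rw [pow_succ, ← ih, ← h.lintegral_exp_portSum s p (n + d), ← hmul]
    refine lintegral_congr fun ω => ?_
    rw [Pi.mul_apply, ← ENNReal.ofReal_mul (Real.exp_pos _).le, ← Real.exp_add, ← mul_add,
      Fin.sum_univ_castSucc]
    congr 3
    simp only [portSum, Pi.add_apply, Finset.sum_add_distrib, Nat.cast_add, Fin.val_castSucc,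
      Fin.val_last]

lemma frameTraffic_eq_sum_fin (T : ℕ) (a : ℕ → ℕ) (x : ℕ → Traffic N) (k : ℕ) :
    frameTraffic T a x k = ∑ m : Fin (a ((k + 1) * T) - a (k * T)), x (a (k * T) + m) := by
  rw [frameTraffic, Finset.sum_Ico_eq_sum_range, Finset.sum_range]

lemma IsCoflowTraffic.lintegral_past_mul_exp_le [IsProbabilityMeasure μ]
    (h : IsCoflowTraffic μ lam ν A X) {k : ℕ}
    {F : Ω → ℝ≥0∞} (hF : IsPast T A X k F) {s u : ℝ} (hu : 0 ≤ u) (p : Fin N ⊕ Fin N)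
    (hp : portMgf ν s p ≤ ENNReal.ofReal (1 + u)) :
    ∫⁻ ω, F ω * ENNReal.ofReal (Real.exp
        (s * portSum p (frameTraffic T (slotCount A ω) (fun m => X m ω) k))) ∂μ ≤
      (∫⁻ ω, F ω ∂μ) * ENNReal.ofReal (Real.exp (lam * T * u)) := by
  have hmain := h.lintegral_past_mul hF
    (g := fun d y => ENNReal.ofReal (Real.exp (s * portSum p (∑ m : Fin d, y m))))
    (γ := fun d => portMgf ν s p ^ d) fun n d => h.lintegral_exp_portSum_block s p n d
  simp only [frameTraffic_eq_sum_fin]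
  rw [hmain]
  refine mul_le_mul_right ?_ _
  simpa using tsum_poissonMeasure_mul_pow_le (lam * T) hu hp

end Moments

/-! ### The frame size -/

section Past

variable {Ω : Type u} {N T : ℕ} {A : ℝ≥0 → Ω → ℕ} {X : ℕ → Ω → Traffic N}

lemma isPast_frameTraffic (k : ℕ) :
    IsPast T A X (k + 1) fun ω => frameTraffic T (slotCount A ω) (fun m => X m ω) k := by
  intro ω ω' h1 h2
  simp only [frameTraffic, ← h1 k k.le_succ, ← h1 (k + 1) le_rfl]
  exact Finset.sum_congr rfl fun m hm => h2 m (Finset.mem_Ico.1 hm).2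

lemma isPast_overflow (k : ℕ) :
    IsPast T A X (k + 1) fun ω => overflow T (slotCount A ω) (fun m => X m ω) k := by
  intro ω ω' h1 h2
  simp only [overflow, isPast_frameTraffic k ω ω' h1 h2]

end Past

/-! ### Chernoff bounds for the overflow of a frame -/

section FrameMoments

variable {Ω : Type u} [MeasurableSpace Ω] {μ : Measure Ω} {N T : ℕ} {lam : ℝ≥0}
  {ν : Fin N → Fin N → ProbabilityMeasure ℕ} {A : ℝ≥0 → Ω → ℕ} {X : ℕ → Ω → Traffic N}

lemma IsCoflowTraffic.isPast_mono (h : IsCoflowTraffic μ lam ν A X) {β : Type*} {F : Ω → β}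
    {k l : ℕ} (hF : IsPast T A X k F) (hkl : k ≤ l) : IsPast T A X l F :=
  fun ω ω' h1 h2 => hF ω ω' (fun j hj => h1 j (hj.trans hkl)) fun m hm =>
    h2 m (hm.trans_le (h.slotCount_mono ω (Nat.mul_le_mul_right T hkl)))

lemma IsCoflowTraffic.isPast_workload (h : IsCoflowTraffic μ lam ν A X) (k : ℕ) :
    IsPast T A X k fun ω => workload T (slotCount A ω) (fun m => X m ω) k := by
  induction k with
  | zero => exact fun _ _ _ _ => rfl
  | succ k ih =>
    intro ω ω' h1 h2
    simp only [workload, h.isPast_mono ih k.le_succ ω ω' h1 h2, isPast_overflow k ω ω' h1 h2]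

/-- Let `M` be the traffic of the busiest port. An overflow forces `M ≥ T`, and there are at most `N
* M` packets. A share `δ` of the exponent pays for `M ^ 2`, the remaining `s - δ` for the event `M ≥
T`, and the sum over ports replaces the maximum. -/
lemma overflow_sq_le (hT : 0 < T) {a : ℕ → ℕ} {x : ℕ → Traffic N} {k : ℕ} {s δ : ℝ} (hδ : 0 < δ)
    (hδs : δ ≤ s) : (overflow T a x k : ℝ) ^ 2 ≤
      N ^ 2 * (4 / δ ^ 2) * Real.exp (-(s - δ) * T) *
        ∑ p, Real.exp (s * portSum p (frameTraffic T a x k)) := by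
  rw [overflow]
  split_ifs with hlt
  · have : 0 ≤ ∑ p, Real.exp (s * portSum p (frameTraffic T a x k)) :=
      Finset.sum_nonneg fun p _ => (Real.exp_pos _).le
    simp only [Nat.cast_zero, ne_eq, OfNat.ofNat_ne_zero, not_false_eq_true, zero_pow]
    positivity
  · set B := frameTraffic T a x k
    obtain ⟨q, hq⟩ := exists_le_portSum hT (not_lt.1 hlt)
    obtain ⟨p, -, hp⟩ := Finset.exists_max_image Finset.univ (fun p => portSum p B)
      ⟨q, Finset.mem_univ q⟩
    have hTp : (T : ℝ) ≤ portSum p B := Nat.cast_le.2 (hq.trans (hp q (Finset.mem_univ q)))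
    set M : ℝ := ((portSum p B : ℕ) : ℝ)
    have hM0 : 0 ≤ M := Nat.cast_nonneg _
    have hpk : (packets B : ℝ) ≤ N * M := by
      rw [packets_eq_sum_portSum, Nat.cast_sum]
      calc ∑ i, (portSum (.inl i) B : ℝ) ≤ ∑ _i : Fin N, M :=
            Finset.sum_le_sum fun i _ => Nat.cast_le.2 (hp _ (Finset.mem_univ _))
        _ = N * M := by simp
    have hsq : M ^ 2 ≤ 4 / δ ^ 2 * Real.exp (δ * M) := by
      have h7 : δ / 2 * M ≤ Real.exp (δ / 2 * M) := by
        linarith [Real.add_one_le_exp (δ / 2 * M)]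
      have h8 : Real.exp (δ * M) = Real.exp (δ / 2 * M) ^ 2 := by
        rw [← Real.exp_nat_mul]; congr 1; push_cast; ring
      have h9 := pow_le_pow_left₀ (by positivity) h7 2
      rw [h8, div_mul_eq_mul_div, le_div_iff₀ (by positivity)]
      nlinarith
    have hexp : Real.exp (δ * M) ≤ Real.exp (-(s - δ) * T) * Real.exp (s * M) := by
      rw [← Real.exp_add]
      refine Real.exp_le_exp.2 ?_
      nlinarith [mul_le_mul_of_nonneg_left hTp (sub_nonneg.2 hδs)]
    have hsingle : Real.exp (s * M) ≤ ∑ p, Real.exp (s * portSum p B) :=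
      Finset.single_le_sum (f := fun p => Real.exp (s * portSum p B))
        (fun p _ => (Real.exp_pos _).le) (Finset.mem_univ p)
    calc (packets B : ℝ) ^ 2 ≤ (N * M) ^ 2 := pow_le_pow_left₀ (Nat.cast_nonneg _) hpk 2
      _ = N ^ 2 * M ^ 2 := by ring
      _ ≤ N ^ 2 * (4 / δ ^ 2 * (Real.exp (-(s - δ) * T) *
            ∑ p, Real.exp (s * portSum p B))) := by
          gcongr
          exact hsq.trans (mul_le_mul_of_nonneg_left
            (hexp.trans (mul_le_mul_of_nonneg_left hsingle (Real.exp_pos _).le)) (by positivity))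
      _ = _ := by ring

lemma packets_le_sum_exp (B : Traffic N) {s : ℝ} (hs : 0 < s) :
    (packets B : ℝ) ≤ 1 / s * ∑ p, Real.exp (s * portSum p B) := by
  rw [packets_eq_sum_portSum, Nat.cast_sum, Fintype.sum_sum_type, mul_add, Finset.mul_sum]
  have h2 : 0 ≤ ∑ j : Fin N, Real.exp (s * portSum (.inr j) B) :=
    Finset.sum_nonneg fun p _ => (Real.exp_pos _).le
  refine le_add_of_le_of_nonneg (Finset.sum_le_sum fun i _ => ?_) (by positivity)
  rw [one_div, inv_mul_eq_div, le_div_iff₀ hs]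
  linarith [Real.add_one_le_exp (s * portSum (.inl i) B), mul_comm s (portSum (.inl i) B : ℝ)]

lemma IsCoflowTraffic.lintegral_past_mul_le [IsProbabilityMeasure μ]
    (h : IsCoflowTraffic μ lam ν A X) {k : ℕ} {F : Ω → ℝ≥0∞} (hF : IsPast T A X k F) {s u c : ℝ}
    (hu : 0 ≤ u) (hc : 0 ≤ c) (hp : ∀ p, portMgf ν s p ≤ ENNReal.ofReal (1 + u)) {Y : Ω → ℝ≥0∞}
    (hY : ∀ ω, Y ω ≤ ENNReal.ofReal (c * ∑ p, Real.exp
      (s * portSum p (frameTraffic T (slotCount A ω) (fun m => X m ω) k)))) :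
    ∫⁻ ω, F ω * Y ω ∂μ ≤
      (∫⁻ ω, F ω ∂μ) * ENNReal.ofReal (c * (2 * N * Real.exp (lam * T * u))) := by
  set e : Fin N ⊕ Fin N → Ω → ℝ≥0∞ := fun p ω => F ω * ENNReal.ofReal (Real.exp
    (s * portSum p (frameTraffic T (slotCount A ω) (fun m => X m ω) k))) with he
  have hme : ∀ p, Measurable (e p) := fun p =>
    h.measurable_of_isPast (k := k + 1) (T := T) fun ω ω' h1 h2 => by
      simp only [he, h.isPast_mono hF k.le_succ ω ω' h1 h2, isPast_frameTraffic k ω ω' h1 h2]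
  calc ∫⁻ ω, F ω * Y ω ∂μ ≤ ∫⁻ ω, ENNReal.ofReal c * ∑ p, e p ω ∂μ := by
        refine lintegral_mono fun ω => (mul_le_mul_right (hY ω) _).trans_eq ?_
        rw [ENNReal.ofReal_mul hc, ENNReal.ofReal_sum_of_nonneg fun p _ => (Real.exp_pos _).le,
          mul_left_comm, Finset.mul_sum]
    _ = ENNReal.ofReal c * ∑ p, ∫⁻ ω, e p ω ∂μ := by
        rw [lintegral_const_mul _ (Finset.measurable_fun_sum _ fun p _ => hme p),
          lintegral_finsetSum _ fun p _ => hme p]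
    _ ≤ ENNReal.ofReal c * ∑ _p : Fin N ⊕ Fin N,
          (∫⁻ ω, F ω ∂μ) * ENNReal.ofReal (Real.exp (lam * T * u)) := by
        gcongr with p
        exact h.lintegral_past_mul_exp_le hF hu p (hp p)
    _ = _ := by
        rw [Finset.sum_const, Finset.card_univ, Fintype.card_sum, Fintype.card_fin, nsmul_eq_mul,
          ENNReal.ofReal_mul hc, ENNReal.ofReal_mul (by positivity),
          show (2 * N : ℝ) = ((N + N : ℕ) : ℝ) by push_cast; ring, ENNReal.ofReal_natCast]
        ring

end FrameMoments

/-! ### Choice of the exponent and of the frame size -/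

section FrameSize

variable {ν : (N : ℕ) → Fin N → Fin N → ProbabilityMeasure ℕ} {lam rho : ℝ≥0}

lemma exists_exponent (hlam : 0 < lam) (hrho : rho < 1) (hν : IsLightTailed ν)
    (hload : ∀ N, (lam : ℝ≥0∞) * meanLoad (ν N) ≤ rho) :
    ∃ s δ v : ℝ, 0 < δ ∧ δ ≤ s ∧ 0 ≤ v ∧ lam * v ≤ s - 2 * δ ∧
      ∀ N p, portMgf (ν N) s p ≤ ENNReal.ofReal (1 + v) := by
  obtain ⟨θ, hθ, C, hC⟩ := hν
  have hlam' : (0 : ℝ) < lam := hlam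
  have hrho' : (rho : ℝ) < 1 := hrho
  have hrho0 : (0 : ℝ) ≤ rho := rho.2
  -- The second entry keeps the second-order part of the moment generating function below half of
  -- the slack `1 - rho`.
  set s : ℝ := min (θ / 2) ((1 - rho) * θ ^ 2 / (32 * lam * (C + 1))) with hs
  have hs0 : 0 < s := lt_min (by positivity) (div_pos (mul_pos (by linarith) (by positivity))
    (by positivity))
  have hs1 : s ≤ θ / 2 := min_le_left _ _
  have hs2 : lam * (s * (16 / θ ^ 2) * C) ≤ (1 - rho) / 2 := by
    have h1 : s ≤ (1 - rho) * θ ^ 2 / (32 * lam * (C + 1)) := min_le_right _ _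
    rw [le_div_iff₀ (by positivity)] at h1
    have h2 : lam * (s * (16 / θ ^ 2) * C) = s * (16 * lam * C) / θ ^ 2 := by ring
    rw [h2, div_le_iff₀ (by positivity)]
    nlinarith [mul_pos hs0 hlam']
  have hmgf : ∀ N p, portMgf (ν N) θ p ≤ C := by
    rintro N (i | j)
    · exact (hC N).1 i
    · exact (hC N).2 j
  -- With this `δ`, `s - 2 * δ = s * rho + s * (1 - rho) / 2`: the first-order load plus half of the
  -- slack. One `δ` is spent on `M ^ 2` in `overflow_sq_le`, the other gives the decay `exp (-δ *
  -- T)`.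
  refine ⟨s, s * (1 - rho) / 4, s * (rho / lam) + s ^ 2 * (16 / θ ^ 2) * C, ?_, ?_, by positivity,
    ?_, fun N p => portMgf_le hθ hs0.le hs1 (by positivity) (hmgf N p) ?_⟩
  · exact div_pos (mul_pos hs0 (by linarith)) (by norm_num)
  · nlinarith
  · have h3 : lam * (s * (rho / lam) + s ^ 2 * (16 / θ ^ 2) * C) =
        s * rho + s * (lam * (s * (16 / θ ^ 2) * C)) := by
      field_simp
    rw [h3]
    nlinarith
  · rw [ENNReal.ofReal_div_of_pos hlam', ENNReal.ofReal_coe_nnreal, ENNReal.ofReal_coe_nnreal,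
      ENNReal.le_div_iff_mul_le (Or.inl (by simpa using hlam.ne')) (Or.inl ENNReal.coe_ne_top),
      mul_comm]
    exact hload N

/-- Frames of logarithmic length in which non-conforming coflows are rare. -/
lemma exists_frameSize (hlam : 0 < lam) (hrho : rho < 1) (hν : IsLightTailed ν)
    (hload : ∀ N, (lam : ℝ≥0∞) * meanLoad (ν N) ≤ rho) :
    ∃ T : ℕ → ℕ, (∀ N, 1 ≤ T N) ∧
      ((fun N : ℕ => (T N : ℝ)) =O[atTop] fun N : ℕ => Real.log N) ∧
      ∀ (N : ℕ) (Ω : Type u) [MeasurableSpace Ω] (μ : Measure Ω) [IsProbabilityMeasure μ]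
        (A : ℝ≥0 → Ω → ℕ) (X : ℕ → Ω → Traffic N), IsCoflowTraffic μ lam (ν N) A X →
        (∀ (k : ℕ) (F : Ω → ℝ≥0∞), IsPast (T N) A X k F →
          ∫⁻ ω, F ω * (overflow (T N) (slotCount A ω) (fun m => X m ω) k : ℝ≥0∞) ^ 2 ∂μ ≤
            (∫⁻ ω, F ω ∂μ) * 4⁻¹) ∧
        ∃ B : ℝ≥0, ∀ k, ∫⁻ ω, (packets (frameTraffic (T N) (slotCount A ω)
          (fun m => X m ω) k) : ℝ≥0∞) ∂μ ≤ B := by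
  obtain ⟨s, δ, v, hδ, hδs, hv, hlv, hmgf⟩ := exists_exponent hlam hrho hν hload
  have hs : 0 < s := hδ.trans_le hδs
  -- The prefactor to beat is `8 / δ ^ 2 * N ^ 3`, from `N ^ 2 * (4 / δ ^ 2)` and the `2 * N` ports;
  -- the target `1 / 4` turns `8` into `32`. The added `1` makes `L` nonnegative.
  set L : ℝ := Real.log (32 / δ ^ 2 + 1) with hL
  have hL0 : 0 ≤ L := Real.log_nonneg (by have : 0 ≤ 32 / δ ^ 2 := by positivity
                                          linarith)
  refine ⟨fun N => ⌈(3 * Real.log N + L) / δ⌉₊ + 1, fun N => Nat.le_add_left _ _, ?_, ?_⟩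
  · refine IsBigO.of_bound (3 / δ + (L / δ + 2)) ?_
    filter_upwards [eventually_ge_atTop 3] with N hN
    have hlog : 1 ≤ Real.log N := by
      rw [Real.le_log_iff_exp_le (by positivity)]
      have : (3 : ℝ) ≤ N := by exact_mod_cast hN
      linarith [Real.exp_one_lt_d9]
    rw [Real.norm_of_nonneg (by positivity), Real.norm_of_nonneg (by linarith)]
    have hceil := Nat.ceil_lt_add_one (show 0 ≤ (3 * Real.log N + L) / δ by positivity)
    push_cast
    have h1 : (3 * Real.log N + L) / δ = 3 / δ * Real.log N + L / δ := by ring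
    have h2 : 0 ≤ L / δ + 2 := by positivity
    nlinarith
  · intro N Ω _ μ _ A X h
    set T := ⌈(3 * Real.log N + L) / δ⌉₊ + 1 with hTdef
    have hTδ : 3 * Real.log N + L ≤ T * δ := by
      rw [← div_le_iff₀ hδ, hTdef]
      push_cast
      linarith [Nat.le_ceil ((3 * Real.log N + L) / δ)]
    constructor
    · intro k F hF
      refine (h.lintegral_past_mul_le hF hv
        (c := N ^ 2 * (4 / δ ^ 2) * Real.exp (-(s - δ) * T)) (by positivity) (hmgf N)
        fun ω => ?_).trans (mul_le_mul_right ?_ _)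
      · rw [← ENNReal.ofReal_natCast, ← ENNReal.ofReal_pow (Nat.cast_nonneg _)]
        exact ENNReal.ofReal_le_ofReal (overflow_sq_le (Nat.succ_pos _) hδ hδs)
      · have h4 : (4⁻¹ : ℝ≥0∞) = ENNReal.ofReal 4⁻¹ := by
          rw [ENNReal.ofReal_inv_of_pos (by norm_num), ENNReal.ofReal_ofNat]
        rw [h4]
        refine ENNReal.ofReal_le_ofReal ?_
        rcases N.eq_zero_or_pos with rfl | hN
        · simp
        · have hN' : (0 : ℝ) < N := Nat.cast_pos.2 hN
          have hexp : Real.exp (-(s - δ) * T) * Real.exp (lam * T * v) ≤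
              ((N : ℝ) ^ 3 * (32 / δ ^ 2 + 1))⁻¹ := by
            have hrw : ((N : ℝ) ^ 3 * (32 / δ ^ 2 + 1))⁻¹ = Real.exp (-(3 * Real.log N + L)) := by
              rw [Real.exp_neg, Real.exp_add, hL, Real.exp_log (by positivity),
                show 3 * Real.log N = Real.log ((N : ℝ) ^ 3) by rw [Real.log_pow]; norm_num,
                Real.exp_log (by positivity)]
            rw [hrw, ← Real.exp_add]
            refine Real.exp_le_exp.2 ?_
            have hT0 : (0 : ℝ) ≤ T := Nat.cast_nonneg _
            nlinarith [mul_le_mul_of_nonneg_right hlv hT0]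
          calc (N : ℝ) ^ 2 * (4 / δ ^ 2) * Real.exp (-(s - δ) * T) *
                (2 * N * Real.exp (lam * T * v))
              = 8 / δ ^ 2 * N ^ 3 * (Real.exp (-(s - δ) * T) * Real.exp (lam * T * v)) := by ring
            _ ≤ 8 / δ ^ 2 * N ^ 3 * ((N : ℝ) ^ 3 * (32 / δ ^ 2 + 1))⁻¹ := by gcongr
            _ ≤ 4⁻¹ := by
                rw [← div_eq_mul_inv, div_le_iff₀ (by positivity)]
                have : 0 ≤ (N : ℝ) ^ 3 := by positivity
                have : 8 / δ ^ 2 = 4⁻¹ * (32 / δ ^ 2) := by ring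
                rw [this]
                nlinarith
    · refine ⟨(1 / s * (2 * N * Real.exp (lam * T * v))).toNNReal, fun k => ?_⟩
      have hpk := h.lintegral_past_mul_le (T := T) (k := k) (F := fun _ => 1)
        (fun _ _ _ _ => rfl) hv (c := 1 / s) (by positivity) (hmgf N)
        (Y := fun ω => (packets (frameTraffic T (slotCount A ω) (fun m => X m ω) k) : ℝ≥0∞))
        fun ω => by
          rw [← ENNReal.ofReal_natCast]
          exact ENNReal.ofReal_le_ofReal (packets_le_sum_exp _ hs)
      simp only [one_mul, lintegral_one, measure_univ] at hpk
      exact hpk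

end FrameSize

/-! ### Stability and delay of the CAB policy -/

section Workload

variable {Ω : Type u} {N T : ℕ} {A : ℝ≥0 → Ω → ℕ} {X : ℕ → Ω → Traffic N}

/-- Indicator of the event that fewer than `n` coflows arrive before frame `k`. -/
noncomputable def early (T : ℕ) (A : ℝ≥0 → Ω → ℕ) (n : ℕ∞) (k : ℕ) (ω : Ω) : ℝ≥0∞ :=
  if (slotCount A ω (k * T) : ℕ∞) < n then 1 else 0

/-- `overflow` as an extended nonnegative random variable. -/
noncomputable def randomOverflow (T : ℕ) (A : ℝ≥0 → Ω → ℕ) (X : ℕ → Ω → Traffic N) (k : ℕ)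
    (ω : Ω) : ℝ≥0∞ :=
  (overflow T (slotCount A ω) (fun m => X m ω) k : ℝ≥0∞)

/-- `workload` as an extended nonnegative random variable. -/
noncomputable def randomWorkload (T : ℕ) (A : ℝ≥0 → Ω → ℕ) (X : ℕ → Ω → Traffic N) (k : ℕ)
    (ω : Ω) : ℝ≥0∞ :=
  (workload T (slotCount A ω) (fun m => X m ω) k : ℝ≥0∞)

/-- Expanding `(w + y - 1) ^ 2` produces the drift `-2 * w`. Since `y ≤ y ^ 2` for naturals, every
term in `y` is controlled by its second moment alone. -/
lemma workload_succ_sq_add_le (a : ℕ → ℕ) (x : ℕ → Traffic N) (k : ℕ) :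
    workload T a x (k + 1) ^ 2 + 2 * workload T a x k ≤
      workload T a x k ^ 2 + 2 * (workload T a x k * overflow T a x k ^ 2) +
        (overflow T a x k ^ 2 + 1) := by
  rw [workload]
  generalize workload T a x k = w
  generalize overflow T a x k = y
  have hy : y ≤ y ^ 2 := Nat.le_self_pow two_ne_zero y
  rcases Nat.eq_zero_or_pos (w + y) with h | h
  · have hw : w = 0 := by omega
    have hy : y = 0 := by omega
    simp [hw, hy]
  · obtain ⟨z, hz⟩ : ∃ z, w + y = z + 1 := ⟨w + y - 1, by omega⟩
    rw [hz, Nat.add_sub_cancel]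
    zify at hz hy ⊢
    have hz' : (z : ℤ) = w + y - 1 := by linarith
    have hw0 : (0 : ℤ) ≤ w := Nat.cast_nonneg w
    have hy0 : (0 : ℤ) ≤ y := Nat.cast_nonneg y
    rw [hz']
    nlinarith [mul_le_mul_of_nonneg_left hy hw0]

lemma isPast_early (n : ℕ∞) (k : ℕ) : IsPast T A X k (early T A n k) := fun ω ω' h1 _ => by
  simp only [early, h1 k le_rfl]

lemma isPast_randomOverflow (k : ℕ) : IsPast T A X (k + 1) (randomOverflow T A X k) :=
  fun ω ω' h1 h2 => by simp only [randomOverflow, isPast_overflow k ω ω' h1 h2]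

lemma IsPast.mul {k : ℕ} {F F' : Ω → ℝ≥0∞} (hF : IsPast T A X k F) (hF' : IsPast T A X k F') :
    IsPast T A X k fun ω => F ω * F' ω := fun ω ω' h1 h2 => by
  simp only [hF ω ω' h1 h2, hF' ω ω' h1 h2]

lemma randomOverflow_le_sq (k : ℕ) (ω : Ω) :
    randomOverflow T A X k ω ≤ randomOverflow T A X k ω ^ 2 := by
  rw [randomOverflow, ← Nat.cast_pow]
  exact Nat.cast_le.2 (Nat.le_self_pow two_ne_zero _)

lemma sum_early_mul_le {a : ℕ → ℕ} (ha : Monotone a) (n K : ℕ) :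
    ∑ k ∈ Finset.range K, (if a (k * T) < n ∧ a ((k + 1) * T) - a (k * T) ≠ 0 then 1 else 0) ≤
      n := by
  -- Each nonempty frame that starts early uses up at least one of the first `n` coflows; the
  -- minimum is the invariant that makes the induction close.
  suffices h : ∑ k ∈ Finset.range K,
      (if a (k * T) < n ∧ a ((k + 1) * T) - a (k * T) ≠ 0 then 1 else 0) ≤ min n (a (K * T)) from
    h.trans (min_le_left _ _)
  induction K with
  | zero => simp
  | succ K ih =>
    have := ha (Nat.mul_le_mul_right T K.le_succ)
    simp only [Nat.succ_eq_add_one] at this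
    rw [Finset.sum_range_succ]
    split_ifs <;> omega

/-- The bound is uniform in `T ≥ 1`, so counting frames instead of coflows costs a factor
independent of `N`. -/
lemma one_sub_exp_le_tsum_poissonMeasure {lam : ℝ≥0} (hT : 0 < T) :
    ENNReal.ofReal (1 - Real.exp (-lam)) ≤
      ∑' d, poissonMeasure (lam * T) {d} * (if d ≠ 0 then 1 else 0) := by
  have htot : ∑' d : ℕ, poissonMeasure (lam * T) {d} = 1 := by
    have h := lintegral_countable' (μ := poissonMeasure (lam * T)) fun _ => 1
    simpa only [lintegral_one, measure_univ, one_mul] using h.symm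
  have hsplit : (1 : ℝ≥0∞) = ENNReal.ofReal (Real.exp (-(lam * T))) +
      ∑' d, poissonMeasure (lam * T) {d} * (if d ≠ 0 then 1 else 0) := by
    refine htot.symm.trans ?_
    rw [tsum_eq_zero_add' ENNReal.summable, poissonMeasure_singleton]
    conv_rhs => rw [tsum_eq_zero_add' ENNReal.summable]
    simp
  rw [ENNReal.ofReal_sub _ (Real.exp_pos _).le, ENNReal.ofReal_one, tsub_le_iff_left]
  refine hsplit.trans_le (add_le_add (ENNReal.ofReal_le_ofReal (Real.exp_le_exp.2 ?_)) le_rfl)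
  have : (1 : ℝ) ≤ T := by exact_mod_cast hT
  nlinarith [lam.2, show (0 : ℝ) ≤ lam from lam.2]

end Workload

/-! ### Quadratic drift of the workload over early frames -/

section Drift

variable {Ω : Type u} [MeasurableSpace Ω] {μ : Measure Ω} {N T : ℕ} {lam : ℝ≥0}
  {ν : Fin N → Fin N → ProbabilityMeasure ℕ} {A : ℝ≥0 → Ω → ℕ} {X : ℕ → Ω → Traffic N}

/-- This direction holds without measurability, so it applies to delays and backlogs as they stand.
-/
lemma sum_lintegral_le_lintegral_sum {α : Type*} (s : Finset α) (f : α → Ω → ℝ≥0∞) :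
    ∑ m ∈ s, ∫⁻ ω, f m ω ∂μ ≤ ∫⁻ ω, ∑ m ∈ s, f m ω ∂μ := by
  classical
  induction s using Finset.induction_on with
  | empty => simp
  | insert m s hm ih =>
    simp only [Finset.sum_insert hm]
    exact (add_le_add le_rfl ih).trans (le_lintegral_add _ _)

/-- Non-conforming coflows are rare, whatever happened before. -/
def HasRareOverflow (μ : Measure Ω) (T : ℕ) (A : ℝ≥0 → Ω → ℕ) (X : ℕ → Ω → Traffic N) : Prop :=
  ∀ (k : ℕ) (F : Ω → ℝ≥0∞), IsPast T A X k F →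
    ∫⁻ ω, F ω * randomOverflow T A X k ω ^ 2 ∂μ ≤ (∫⁻ ω, F ω ∂μ) * 4⁻¹

lemma early_succ_le (h : IsCoflowTraffic μ lam ν A X) (n : ℕ∞) (k : ℕ) (ω : Ω) :
    early T A n (k + 1) ω ≤ early T A n k ω := by
  rw [early, early]
  split_ifs with h1 h2
  · exact le_rfl
  · exact absurd (lt_of_le_of_lt (Nat.cast_le.2
      (h.slotCount_mono ω (Nat.mul_le_mul_right T k.le_succ))) h1) h2
  · exact zero_le
  · exact le_rfl

lemma IsCoflowTraffic.isPast_randomWorkload (h : IsCoflowTraffic μ lam ν A X) (k : ℕ) :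
    IsPast T A X k (randomWorkload T A X k) := fun ω ω' h1 h2 => by
  simp only [randomWorkload, h.isPast_workload k ω ω' h1 h2]

/-- A crude bound, needed only for finiteness, so that the workload sum can be cancelled after
telescoping. -/
lemma IsCoflowTraffic.lintegral_randomWorkload_le [IsProbabilityMeasure μ]
    (h : IsCoflowTraffic μ lam ν A X)
    (hover : HasRareOverflow μ T A X) (k : ℕ) :
    ∫⁻ ω, randomWorkload T A X k ω ∂μ ≤ k := by
  induction k with
  | zero => simp [randomWorkload, workload]
  | succ k ih =>
    calc ∫⁻ ω, randomWorkload T A X (k + 1) ω ∂μ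
        ≤ ∫⁻ ω, (randomWorkload T A X k ω + 1 * randomOverflow T A X k ω ^ 2) ∂μ := by
          refine lintegral_mono fun ω => ?_
          rw [one_mul]
          refine le_trans ?_ (add_le_add le_rfl (randomOverflow_le_sq k ω))
          rw [randomWorkload, randomWorkload, randomOverflow, workload, ← Nat.cast_add]
          exact Nat.cast_le.2 (Nat.sub_le _ _)
      _ = ∫⁻ ω, randomWorkload T A X k ω ∂μ + ∫⁻ ω, 1 * randomOverflow T A X k ω ^ 2 ∂μ :=
          lintegral_add_left (h.measurable_of_isPast (h.isPast_randomWorkload k)) _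
      _ ≤ k + 1 := by
          refine add_le_add ih ((hover k (fun _ => 1) fun _ _ _ _ => rfl).trans ?_)
          simp only [lintegral_one, measure_univ, one_mul]
          exact ENNReal.inv_le_one.2 (by norm_num)
      _ = _ := by push_cast; rfl

/-- The pointwise drift is multiplied by an indicator of the past. Rare overflow, applied to `I` and
to `I * W`, makes the positive workload term at most half of the negative one. -/
lemma IsCoflowTraffic.drift (h : IsCoflowTraffic μ lam ν A X) (hover : HasRareOverflow μ T A X)
    (n : ℕ∞) (k : ℕ) :
    ∫⁻ ω, early T A n (k + 1) ω * randomWorkload T A X (k + 1) ω ^ 2 ∂μ +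
        2 * ∫⁻ ω, early T A n k ω * randomWorkload T A X k ω ∂μ ≤
      ∫⁻ ω, early T A n k ω * randomWorkload T A X k ω ^ 2 ∂μ +
        ∫⁻ ω, early T A n k ω * randomWorkload T A X k ω ∂μ +
        2 * ∫⁻ ω, early T A n k ω ∂μ := by
  set I := early T A n k with hI
  set W := randomWorkload T A X k with hW
  set Y := randomOverflow T A X k with hY
  have pI : IsPast T A X k I := isPast_early n k
  have pW : IsPast T A X k W := h.isPast_randomWorkload k
  have pY : IsPast T A X (k + 1) Y := isPast_randomOverflow k
  have mI : Measurable I := h.measurable_of_isPast pI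
  have mW : Measurable W := h.measurable_of_isPast pW
  have mY : Measurable Y := h.measurable_of_isPast pY
  have hpt : ∀ ω, early T A n (k + 1) ω * randomWorkload T A X (k + 1) ω ^ 2 + 2 * (I ω * W ω) ≤
      I ω * W ω ^ 2 + 2 * ((I ω * W ω) * Y ω ^ 2) + (I ω * Y ω ^ 2 + I ω) := by
    intro ω
    have hnat : randomWorkload T A X (k + 1) ω ^ 2 + 2 * W ω ≤
        W ω ^ 2 + 2 * (W ω * Y ω ^ 2) + (Y ω ^ 2 + 1) := by
      simp only [hW, hY, randomWorkload, randomOverflow]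
      exact_mod_cast workload_succ_sq_add_le (T := T) (slotCount A ω) (fun m => X m ω) k
    calc early T A n (k + 1) ω * randomWorkload T A X (k + 1) ω ^ 2 + 2 * (I ω * W ω)
        ≤ I ω * randomWorkload T A X (k + 1) ω ^ 2 + 2 * (I ω * W ω) := by
          gcongr
          exact early_succ_le h n k ω
      _ = I ω * (randomWorkload T A X (k + 1) ω ^ 2 + 2 * W ω) := by ring
      _ ≤ I ω * (W ω ^ 2 + 2 * (W ω * Y ω ^ 2) + (Y ω ^ 2 + 1)) := by gcongr
      _ = _ := by ring
  have h1 := hover k _ (pI.mul pW)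
  have h2 := hover k _ pI
  calc ∫⁻ ω, early T A n (k + 1) ω * randomWorkload T A X (k + 1) ω ^ 2 ∂μ +
        2 * ∫⁻ ω, I ω * W ω ∂μ
      = ∫⁻ ω, (early T A n (k + 1) ω * randomWorkload T A X (k + 1) ω ^ 2 +
          2 * (I ω * W ω)) ∂μ := by
        rw [lintegral_add_right _ (by fun_prop), lintegral_const_mul _ (by fun_prop)]
    _ ≤ ∫⁻ ω, (I ω * W ω ^ 2 + 2 * ((I ω * W ω) * Y ω ^ 2) + (I ω * Y ω ^ 2 + I ω)) ∂μ :=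
        lintegral_mono hpt
    _ = ∫⁻ ω, I ω * W ω ^ 2 ∂μ + 2 * ∫⁻ ω, (I ω * W ω) * Y ω ^ 2 ∂μ +
          (∫⁻ ω, I ω * Y ω ^ 2 ∂μ + ∫⁻ ω, I ω ∂μ) := by
        rw [lintegral_add_left (by fun_prop), lintegral_add_left (by fun_prop),
          lintegral_add_left (by fun_prop), lintegral_const_mul _ (by fun_prop)]
    _ ≤ ∫⁻ ω, I ω * W ω ^ 2 ∂μ + ∫⁻ ω, I ω * W ω ∂μ + 2 * ∫⁻ ω, I ω ∂μ := by
        have h4 : (4⁻¹ : ℝ≥0∞) ≤ 1 := ENNReal.inv_le_one.2 (by norm_num)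
        have h24 : (2 : ℝ≥0∞) * 4⁻¹ ≤ 1 := by
          rw [← div_eq_mul_inv]
          exact ENNReal.div_le_of_le_mul (by norm_num)
        refine add_le_add (add_le_add le_rfl ?_) ?_
        · refine (mul_le_mul_right h1 2).trans ?_
          rw [mul_left_comm]
          exact mul_le_of_le_one_right' h24
        · rw [two_mul]
          exact add_le_add (h2.trans (mul_le_of_le_one_right' h4)) le_rfl

lemma IsCoflowTraffic.sum_lintegral_early_mul_randomWorkload_le [IsProbabilityMeasure μ]
    (h : IsCoflowTraffic μ lam ν A X) (hover : HasRareOverflow μ T A X) (n : ℕ∞) (K : ℕ) :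
    ∑ k ∈ Finset.range K, ∫⁻ ω, early T A n k ω * randomWorkload T A X k ω ∂μ ≤
      2 * ∑ k ∈ Finset.range K, ∫⁻ ω, early T A n k ω ∂μ := by
  have htel : ∫⁻ ω, early T A n K ω * randomWorkload T A X K ω ^ 2 ∂μ +
      2 * ∑ k ∈ Finset.range K, ∫⁻ ω, early T A n k ω * randomWorkload T A X k ω ∂μ ≤
      ∑ k ∈ Finset.range K, ∫⁻ ω, early T A n k ω * randomWorkload T A X k ω ∂μ +
        2 * ∑ k ∈ Finset.range K, ∫⁻ ω, early T A n k ω ∂μ := by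
    induction K with
    | zero => simp [randomWorkload, workload]
    | succ K ih =>
      have hd := h.drift hover n K
      rw [Finset.sum_range_succ, Finset.sum_range_succ, mul_add, mul_add]
      calc _ = (∫⁻ ω, early T A n (K + 1) ω * randomWorkload T A X (K + 1) ω ^ 2 ∂μ +
            2 * ∫⁻ ω, early T A n K ω * randomWorkload T A X K ω ∂μ) +
            2 * ∑ k ∈ Finset.range K, ∫⁻ ω, early T A n k ω * randomWorkload T A X k ω ∂μ := by
            ring
        _ ≤ _ := add_le_add hd le_rfl
        _ = (∫⁻ ω, early T A n K ω * randomWorkload T A X K ω ^ 2 ∂μ +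
            2 * ∑ k ∈ Finset.range K, ∫⁻ ω, early T A n k ω * randomWorkload T A X k ω ∂μ) +
            (∫⁻ ω, early T A n K ω * randomWorkload T A X K ω ∂μ +
              2 * ∫⁻ ω, early T A n K ω ∂μ) := by ring
        _ ≤ _ := add_le_add ih le_rfl
        _ = _ := by ring
  have hfin : ∑ k ∈ Finset.range K, ∫⁻ ω, early T A n k ω * randomWorkload T A X k ω ∂μ ≠ ⊤ := by
    refine ENNReal.sum_ne_top.2 fun k _ => ne_top_of_le_ne_top (ENNReal.natCast_ne_top k) ?_
    refine le_trans (lintegral_mono fun ω => ?_) (h.lintegral_randomWorkload_le hover k)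
    refine mul_le_of_le_one_left' ?_
    rw [early]
    split_ifs <;> simp
  have := le_trans le_add_self htel
  rw [two_mul] at this
  exact (ENNReal.add_le_add_iff_left hfin).1 this

/-- The integrand is at most `I * W * Y ^ 2 + 2 * I * Y ^ 2`. The factor `1 / 4` and the bound on
the workload sum turn the two parts into one half of the right-hand side each. -/
lemma IsCoflowTraffic.sum_lintegral_overflow_cost_le [IsProbabilityMeasure μ]
    (h : IsCoflowTraffic μ lam ν A X) (hover : HasRareOverflow μ T A X) (n : ℕ∞) (K : ℕ) :
    ∑ k ∈ Finset.range K, ∫⁻ ω, early T A n k ω * (randomOverflow T A X k ω *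
        (randomWorkload T A X k ω + randomOverflow T A X k ω + 1)) ∂μ ≤
      ∑ k ∈ Finset.range K, ∫⁻ ω, early T A n k ω ∂μ := by
  have hterm : ∀ k, ∫⁻ ω, early T A n k ω * (randomOverflow T A X k ω *
        (randomWorkload T A X k ω + randomOverflow T A X k ω + 1)) ∂μ ≤
      (∫⁻ ω, early T A n k ω * randomWorkload T A X k ω ∂μ) * 4⁻¹ +
        2 * ((∫⁻ ω, early T A n k ω ∂μ) * 4⁻¹) := by
    intro k
    set I := early T A n k with hI
    set W := randomWorkload T A X k with hW
    set Y := randomOverflow T A X k with hY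
    have pI : IsPast T A X k I := isPast_early n k
    have pW : IsPast T A X k W := h.isPast_randomWorkload k
    have mI : Measurable I := h.measurable_of_isPast pI
    have mW : Measurable W := h.measurable_of_isPast pW
    have mY : Measurable Y := h.measurable_of_isPast (isPast_randomOverflow k)
    calc ∫⁻ ω, I ω * (Y ω * (W ω + Y ω + 1)) ∂μ
        ≤ ∫⁻ ω, ((I ω * W ω) * Y ω ^ 2 + 2 * (I ω * Y ω ^ 2)) ∂μ := by
          refine lintegral_mono fun ω => ?_
          have hY2 : Y ω ≤ Y ω ^ 2 := randomOverflow_le_sq k ω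
          calc I ω * (Y ω * (W ω + Y ω + 1)) = I ω * (W ω * Y ω + Y ω ^ 2 + Y ω) := by ring
            _ ≤ I ω * (W ω * Y ω ^ 2 + Y ω ^ 2 + Y ω ^ 2) := by gcongr
            _ = _ := by ring
      _ = ∫⁻ ω, (I ω * W ω) * Y ω ^ 2 ∂μ + 2 * ∫⁻ ω, I ω * Y ω ^ 2 ∂μ := by
          rw [lintegral_add_left (by fun_prop), lintegral_const_mul _ (by fun_prop)]
      _ ≤ _ := add_le_add (hover k _ (pI.mul pW)) (mul_le_mul_right (hover k _ pI) 2)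
  refine (Finset.sum_le_sum fun k _ => hterm k).trans ?_
  rw [Finset.sum_add_distrib, ← Finset.sum_mul, ← Finset.mul_sum, ← Finset.sum_mul]
  refine (add_le_add (mul_le_mul_left
    (h.sum_lintegral_early_mul_randomWorkload_le hover n K) _) le_rfl).trans_eq ?_
  generalize ∑ k ∈ Finset.range K, ∫⁻ ω, early T A n k ω ∂μ = J
  calc 2 * J * 4⁻¹ + 2 * (J * 4⁻¹) = J * (4 * 4⁻¹) := by ring
    _ = J := by rw [ENNReal.mul_inv_cancel (by norm_num) (by norm_num), mul_one]

lemma IsCoflowTraffic.sum_lintegral_early_le [IsProbabilityMeasure μ]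
    (h : IsCoflowTraffic μ lam ν A X) (hlam : 0 < lam)
    (hT : 0 < T) (n K : ℕ) :
    ∑ k ∈ Finset.range K, ∫⁻ ω, early T A n k ω ∂μ ≤
      n * (ENNReal.ofReal (1 - Real.exp (-lam)))⁻¹ := by
  set κ := ENNReal.ofReal (1 - Real.exp (-lam)) with hκ
  have hκ0 : κ ≠ 0 := by
    rw [hκ, ENNReal.ofReal_ne_zero_iff, sub_pos, Real.exp_lt_one_iff]
    exact neg_lt_zero.2 hlam
  rw [← div_eq_mul_inv, ENNReal.le_div_iff_mul_le (Or.inl hκ0) (Or.inl ENNReal.ofReal_ne_top),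
    Finset.sum_mul]
  have hterm : ∀ k, (∫⁻ ω, early T A n k ω ∂μ) * κ ≤ ∫⁻ ω, early T A n k ω *
      (if slotCount A ω ((k + 1) * T) - slotCount A ω (k * T) ≠ 0 then 1 else 0) ∂μ := by
    intro k
    rw [h.lintegral_past_mul (isPast_early n k) (g := fun d _ => if d ≠ 0 then 1 else 0)
      (γ := fun d => if d ≠ 0 then 1 else 0) fun n d => by simp]
    exact mul_le_mul_right (one_sub_exp_le_tsum_poissonMeasure hT) _
  refine (Finset.sum_le_sum fun k _ => hterm k).trans
    ((sum_lintegral_le_lintegral_sum _ _).trans ?_)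
  calc _ ≤ ∫⁻ _ω, (n : ℝ≥0∞) ∂μ := by
        refine lintegral_mono fun ω => ?_
        refine le_trans (le_of_eq ?_)
          (Nat.cast_le.2 (sum_early_mul_le (T := T) (h.slotCount_mono ω) n K))
        rw [Nat.cast_sum]
        refine Finset.sum_congr rfl fun k _ => ?_
        simp only [early, Nat.cast_lt, ← ite_and, mul_ite, mul_one, mul_zero, Nat.cast_ite,
          Nat.cast_one, Nat.cast_zero]
        split_ifs <;> simp_all
    _ = n := by simp

/-- The expected number of early frames is finite, so almost surely not every frame is early. -/
lemma IsCoflowTraffic.ae_exists_le_slotCount [IsProbabilityMeasure μ]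
    (h : IsCoflowTraffic μ lam ν A X) (hlam : 0 < lam)
    (hT : 0 < T) (n : ℕ) : ∀ᵐ ω ∂μ, ∃ K, n ≤ slotCount A ω (K * T) := by
  have hm : ∀ k, Measurable (early T A n k) := fun k =>
    h.measurable_of_isPast (isPast_early n k)
  have hfin : ∫⁻ ω, ∑' k, early T A n k ω ∂μ ≠ ⊤ := by
    rw [lintegral_tsum fun k => (hm k).aemeasurable]
    refine ne_top_of_le_ne_top ?_ (ENNReal.tsum_le_of_sum_range_le
      fun K => h.sum_lintegral_early_le hlam hT n K)
    refine ENNReal.mul_ne_top (ENNReal.natCast_ne_top n) (ENNReal.inv_ne_top.2 ?_)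
    rw [ENNReal.ofReal_ne_zero_iff, sub_pos, Real.exp_lt_one_iff]
    exact neg_lt_zero.2 hlam
  filter_upwards [ae_lt_top (Measurable.tsum hm) hfin] with ω hω
  by_contra hcon
  push Not at hcon
  have hone : ∀ k, early T A n k ω = 1 := fun k => if_pos (Nat.cast_lt.2 (hcon k))
  simp [hone] at hω

end Drift

section Performance

variable {Ω : Type u} [MeasurableSpace Ω] {μ : Measure Ω} {N T : ℕ}
  {lam : ℝ≥0} {ν : Fin N → Fin N → ProbabilityMeasure ℕ} {A : ℝ≥0 → Ω → ℕ}
  {X : ℕ → Ω → Traffic N} {G : Traffic N → ℕ → Traffic N}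

lemma IsCoflowTraffic.measurable_overflow_cost (h : IsCoflowTraffic μ lam ν A X) (n : ℕ∞) (k : ℕ) :
    Measurable fun ω => early T A n k ω * (randomOverflow T A X k ω *
      (randomWorkload T A X k ω + randomOverflow T A X k ω + 1)) := by
  have mI : Measurable (early T A n k) := h.measurable_of_isPast (isPast_early (X := X) n k)
  have mW : Measurable (randomWorkload T A X k) :=
    h.measurable_of_isPast (h.isPast_randomWorkload k)
  have mY : Measurable (randomOverflow T A X k) := h.measurable_of_isPast (isPast_randomOverflow k)
  fun_prop

lemma IsCoflowTraffic.sum_expectedDelay_cab_le [IsProbabilityMeasure μ]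
    (h : IsCoflowTraffic μ lam ν A X)
    (hlam : 0 < lam) (hT : 0 < T) (hG : IsOptimalClearance G) (hover : HasRareOverflow μ T A X)
    (n : ℕ) :
    ∑ m ∈ Finset.range n, expectedDelay μ A X (cabPolicy G T A X) m ≤
      n * (T * (2 + (ENNReal.ofReal (1 - Real.exp (-lam)))⁻¹)) := by
  set κ := (ENNReal.ofReal (1 - Real.exp (-lam)))⁻¹
  refine (sum_lintegral_le_lintegral_sum _ _).trans ?_
  have hm := fun k => h.measurable_overflow_cost (T := T) n k
  calc _ ≤ ∫⁻ ω, ((2 * T * n : ℕ) + T * ∑' k, early T A n k ω * (randomOverflow T A X k ω *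
          (randomWorkload T A X k ω + randomOverflow T A X k ω + 1))) ∂μ := by
        refine lintegral_mono_ae ?_
        filter_upwards [h.ae_exists_le_slotCount hlam hT n] with ω ⟨K, hK⟩
        -- The number `K` of frames depends on `ω`; passing to the full series removes it before
        -- integrating.
        refine (sum_delay_cab_le hG hT (h.slotCount_mono ω) (h.slotCount_zero ω) hK).trans ?_
        rw [Nat.cast_add, Nat.cast_mul T, Nat.cast_sum]
        refine add_le_add le_rfl (mul_le_mul_right ?_ _)
        refine le_trans (le_of_eq ?_) (ENNReal.sum_le_tsum (Finset.range K))
        refine Finset.sum_congr rfl fun k _ => ?_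
        simp only [early, randomOverflow, randomWorkload, Nat.cast_lt]
        split_ifs <;> simp
    _ = (2 * T * n : ℕ) + T * ∑' k, ∫⁻ ω, early T A n k ω * (randomOverflow T A X k ω *
          (randomWorkload T A X k ω + randomOverflow T A X k ω + 1)) ∂μ := by
        rw [lintegral_add_left measurable_const, lintegral_const, measure_univ, mul_one,
          lintegral_const_mul _ (Measurable.tsum hm), lintegral_tsum fun k => (hm k).aemeasurable]
    _ ≤ (2 * T * n : ℕ) + T * (n * κ) := by
        refine add_le_add le_rfl (mul_le_mul_right ?_ _)
        exact ENNReal.tsum_le_of_sum_range_le fun K =>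
          (h.sum_lintegral_overflow_cost_le hover n K).trans
            (h.sum_lintegral_early_le hlam hT n K)
    _ = _ := by push_cast; ring

lemma IsCoflowTraffic.averageDelay_cab_le [IsProbabilityMeasure μ]
    (h : IsCoflowTraffic μ lam ν A X)
    (hlam : 0 < lam) (hT : 0 < T) (hG : IsOptimalClearance G) (hover : HasRareOverflow μ T A X) :
    averageDelay μ A X (cabPolicy G T A X) ≤
      T * (2 + (ENNReal.ofReal (1 - Real.exp (-lam)))⁻¹) := by
  refine limsup_le_of_le (h := Eventually.of_forall fun n => ?_)
  refine ENNReal.div_le_of_le_mul ?_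
  rw [mul_comm]
  exact h.sum_expectedDelay_cab_le hlam hT hG hover n

lemma IsCoflowTraffic.isStable_cab [IsProbabilityMeasure μ]
    (h : IsCoflowTraffic μ lam ν A X) (hT : 0 < T)
    (hG : IsOptimalClearance G) (hover : HasRareOverflow μ T A X) {B : ℝ≥0}
    (hB : ∀ k, ∫⁻ ω, (packets (frameTraffic T (slotCount A ω) (fun m => X m ω) k) : ℝ≥0∞) ∂μ ≤
      B) :
    IsStable μ A X (cabPolicy G T A X) := by
  have hbound : ∀ t K : ℕ, t ≤ K * T → ∑ s ∈ Finset.range t,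
      ∫⁻ ω, (backlog (slotCount A ω) (fun m => X m ω) (cabPolicy G T A X ω) s : ℝ≥0∞) ∂μ ≤
        K * (2 * T * B + T) := by
    intro t K htK
    have hm := fun k => h.measurable_overflow_cost (T := T) ⊤ k
    have hmp : ∀ k, Measurable fun ω =>
        (packets (frameTraffic T (slotCount A ω) (fun m => X m ω) k) : ℝ≥0∞) := fun k =>
      h.measurable_of_isPast (k := k + 1) (T := T) fun ω ω' h1 h2 => by
        simp only [isPast_frameTraffic k ω ω' h1 h2]
    -- With the threshold `⊤` every frame is early, and the cost estimate bounds the sum over all of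
    -- the first `K` frames by `K`.
    have hearly : ∀ k ω, early T A ⊤ k ω = 1 := fun k ω => if_pos (by simp)
    refine (sum_lintegral_le_lintegral_sum _ _).trans ?_
    calc _ ≤ ∫⁻ ω, (2 * T * ∑ k ∈ Finset.range K,
            (packets (frameTraffic T (slotCount A ω) (fun m => X m ω) k) : ℝ≥0∞) +
          T * ∑ k ∈ Finset.range K, early T A ⊤ k ω * (randomOverflow T A X k ω *
            (randomWorkload T A X k ω + randomOverflow T A X k ω + 1))) ∂μ := by
          refine lintegral_mono fun ω => ?_
          simp only [hearly, one_mul, randomOverflow, randomWorkload]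
          exact_mod_cast sum_backlog_cab_le hG hT (h.slotCount_mono ω) (h.slotCount_zero ω) htK
      _ = 2 * T * ∑ k ∈ Finset.range K, ∫⁻ ω,
            (packets (frameTraffic T (slotCount A ω) (fun m => X m ω) k) : ℝ≥0∞) ∂μ +
          T * ∑ k ∈ Finset.range K, ∫⁻ ω, early T A ⊤ k ω * (randomOverflow T A X k ω *
            (randomWorkload T A X k ω + randomOverflow T A X k ω + 1)) ∂μ := by
          rw [lintegral_add_left ((Finset.measurable_fun_sum _ fun k _ => hmp k).const_mul _),
            lintegral_const_mul _ (Finset.measurable_fun_sum _ fun k _ => hmp k),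
            lintegral_const_mul _ (Finset.measurable_fun_sum _ fun k _ => hm k),
            lintegral_finsetSum _ fun k _ => hmp k, lintegral_finsetSum _ fun k _ => hm k]
      _ ≤ 2 * T * ∑ _k ∈ Finset.range K, (B : ℝ≥0∞) +
          T * ∑ k ∈ Finset.range K, ∫⁻ ω, early T A ⊤ k ω ∂μ := by
          refine add_le_add (mul_le_mul_right (Finset.sum_le_sum fun k _ => hB k) _)
            (mul_le_mul_right (h.sum_lintegral_overflow_cost_le hover ⊤ K) _)
      _ = _ := by
          simp only [hearly, lintegral_one, measure_univ, Finset.sum_const, Finset.card_range,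
            nsmul_eq_mul, mul_one]
          ring
  refine lt_of_le_of_lt (b := (2 * T * B + T : ℝ≥0∞)) (limsup_le_of_le
    (h := Eventually.of_forall fun t => ?_)) ?_
  · refine ENNReal.div_le_of_le_mul ((hbound t t (Nat.le_mul_of_pos_right _ hT)).trans_eq ?_)
    rw [mul_comm]
  · exact_mod_cast ENNReal.coe_lt_top (r := 2 * (T : ℝ≥0) * B + T)

end Performance

/-! ### The logarithmic lower bound -/

section LowerBound

lemma isCrossbar_of_isSchedule {N : ℕ} {a : ℕ → ℕ} {x : ℕ → Traffic N} {σ : ℕ → ℕ → Traffic N}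
    (h : IsSchedule a x σ) (t n : ℕ) : IsCrossbar (σ t n) := by
  by_cases hn : n < a (t + 1)
  · exact (h.crossbar t).mono
      (Finset.single_le_sum (fun m _ i j => Nat.zero_le _) (Finset.mem_range.2 hn))
  · rw [h.arrived t n (not_lt.1 hn)]
    exact isCrossbar_zero

/-- No schedule serves a coflow faster than its clearance time. -/
lemma clearanceTime_le_delay {N : ℕ} {a : ℕ → ℕ} {x : ℕ → Traffic N} {σ : ℕ → ℕ → Traffic N}
    (h : IsSchedule a x σ) (n : ℕ) : (clearanceTime (x n) : ℝ≥0∞) ≤ delay a x σ n := by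
  refine le_iInf₂ fun d hd => Nat.cast_le.2 ?_
  rw [Finset.sum_range_add, Finset.sum_eq_zero fun s hs =>
    h.arrived s n (apply_le_of_lt_arrivalSlot (Finset.mem_range.1 hs)), zero_add] at hd
  have hcb := fun r => isCrossbar_of_isSchedule h (arrivalSlot a n + r) n
  refine max_le (Finset.sup_le fun i _ => ?_) (Finset.sup_le fun j _ => ?_)
  · calc ∑ j, x n i j ≤ ∑ j, ∑ r ∈ Finset.range d, σ (arrivalSlot a n + r) n i j :=
          Finset.sum_le_sum fun j _ => by simpa using hd i j
      _ = ∑ r ∈ Finset.range d, ∑ j, σ (arrivalSlot a n + r) n i j := Finset.sum_comm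
      _ ≤ ∑ _r ∈ Finset.range d, 1 := Finset.sum_le_sum fun r _ => (hcb r).1 i
      _ = d := by simp
  · calc ∑ i, x n i j ≤ ∑ i, ∑ r ∈ Finset.range d, σ (arrivalSlot a n + r) n i j :=
          Finset.sum_le_sum fun i _ => by simpa using hd i j
      _ = ∑ r ∈ Finset.range d, ∑ i, σ (arrivalSlot a n + r) n i j := Finset.sum_comm
      _ ≤ ∑ _r ∈ Finset.range d, 1 := Finset.sum_le_sum fun r _ => (hcb r).2 j
      _ = d := by simp

/-! ### Geometric flow sizes on the diagonal -/

variable {p : unitInterval}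

lemma lintegral_geometricMeasure (hp : p ≠ 0) (f : ℕ → ℝ≥0∞) :
    ∫⁻ y, f y ∂(geometricMeasure p) = ∑' n, f n * ENNReal.ofReal ((1 - p) ^ n * p) := by
  rw [lintegral_countable']
  simp only [geometricMeasure_singleton hp]

lemma lintegral_id_geometricMeasure (hp : p ≠ 0) :
    ∫⁻ y, (y : ℝ≥0∞) ∂(geometricMeasure p) = ENNReal.ofReal ((1 - p) / p) := by
  have hp0 : (0 : ℝ) < p := lt_of_le_of_ne p.2.1 fun h => hp (Subtype.ext h.symm)
  have hp1 : (p : ℝ) ≤ 1 := p.2.2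
  rw [lintegral_geometricMeasure hp]
  have hsum := (hasSum_coe_mul_geometric_of_norm_lt_one (r := (1 - p : ℝ)) (by
    rw [Real.norm_of_nonneg (by linarith)]; linarith)).mul_right (p : ℝ)
  have hterm : ∀ n : ℕ, (n : ℝ≥0∞) * ENNReal.ofReal ((1 - p) ^ n * p) =
      ENNReal.ofReal (n * (1 - p) ^ n * p) := fun n => by
    rw [← ENNReal.ofReal_natCast, ← ENNReal.ofReal_mul (Nat.cast_nonneg _), mul_assoc]
  simp only [hterm]
  rw [← ENNReal.ofReal_tsum_of_nonneg (fun n => mul_nonneg (mul_nonneg (Nat.cast_nonneg _)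
    (pow_nonneg (by linarith) n)) hp0.le) hsum.summable, hsum.tsum_eq]
  rw [sub_sub_cancel]
  congr 1
  field_simp

lemma exists_lintegral_exp_geometricMeasure_le (hp0 : p ≠ 0) (hp1 : p ≠ 1) :
    ∃ θ : ℝ, 0 < θ ∧ ∃ C : ℝ≥0,
      ∫⁻ y, ENNReal.ofReal (Real.exp (θ * (y : ℝ))) ∂(geometricMeasure p) ≤ C := by
  have h0 : (0 : ℝ) < p := lt_of_le_of_ne p.2.1 fun h => hp0 (Subtype.ext h.symm)
  have h1 : (p : ℝ) < 1 := lt_of_le_of_ne p.2.2 fun h => hp1 (Subtype.ext h)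
  have hq : (0 : ℝ) < 1 - p := by linarith
  have hlog : Real.log (1 - p) < 0 := Real.log_neg hq (by linarith)
  -- Half of the decay rate of the geometric tail, so the series remains geometric with ratio `sqrt
  -- (1 - p) < 1`.
  refine ⟨-Real.log (1 - p) / 2, by linarith, ?_⟩
  set r := Real.exp (Real.log (1 - p) / 2) with hr
  have hr1 : r < 1 := Real.exp_lt_one_iff.2 (by linarith)
  have hr0 : 0 < r := Real.exp_pos _
  have hsum := (summable_geometric_of_lt_one hr0.le hr1).mul_right (p : ℝ)
  have hterm : ∀ n : ℕ, ENNReal.ofReal (Real.exp (-Real.log (1 - p) / 2 * n)) *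
      ENNReal.ofReal ((1 - p) ^ n * p) = ENNReal.ofReal (r ^ n * p) := fun n => by
    rw [← ENNReal.ofReal_mul (Real.exp_pos _).le, ← mul_assoc, hr, ← Real.exp_nat_mul]
    congr 2
    rw [show ((1 - p : ℝ)) ^ n = Real.exp (n * Real.log (1 - p)) by
      rw [Real.exp_nat_mul, Real.exp_log hq], ← Real.exp_add]
    congr 1
    ring
  refine ⟨(∑' n, r ^ n * p : ℝ).toNNReal, ?_⟩
  rw [lintegral_geometricMeasure hp0, tsum_congr hterm,
    ← ENNReal.ofReal_tsum_of_nonneg (fun n => by positivity) hsum]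
  exact le_rfl

lemma geometricMeasure_lt (hp : p ≠ 0) (k : ℕ) :
    geometricMeasure p {y | y < k} = ENNReal.ofReal (1 - (1 - p) ^ k) := by
  have hset : {y : ℕ | y < k} = (Finset.range k : Set ℕ) := by ext; simp
  rw [hset, ← sum_measure_singleton]
  simp only [geometricMeasure_singleton hp]
  rw [← ENNReal.ofReal_sum_of_nonneg fun n _ => geometricMeasure_nonneg p n, ← Finset.sum_mul,
    ← mul_neg_geom_sum]
  congr 1
  ring

/-- Independent geometric flow sizes on the diagonal, no other flows. -/
noncomputable def diagonalGeometric (p : unitInterval) (N : ℕ) (i j : Fin N) :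
    ProbabilityMeasure ℕ :=
  if i = j then ⟨geometricMeasure p, inferInstance⟩ else ⟨Measure.dirac 0, inferInstance⟩

lemma diagonalGeometric_self (p : unitInterval) {N : ℕ} (i : Fin N) :
    (diagonalGeometric p N i i : Measure ℕ) = geometricMeasure p := by simp [diagonalGeometric]

lemma diagonalGeometric_of_ne (p : unitInterval) {N : ℕ} {i j : Fin N} (h : i ≠ j) :
    (diagonalGeometric p N i j : Measure ℕ) = Measure.dirac 0 := by simp [diagonalGeometric, h]

lemma lintegral_pi_of_eq_dirac {N : ℕ} (η : Fin N → Measure ℕ) [∀ l, IsProbabilityMeasure (η l)]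
    (i : Fin N) (hη : ∀ l, l ≠ i → η l = Measure.dirac 0) (f : ℝ → ℝ≥0∞) :
    ∫⁻ y, f (∑ l, (y l : ℝ)) ∂(Measure.pi η) = ∫⁻ y, f y ∂(η i) := by
  have hzero : ∀ᵐ y ∂(Measure.pi η), ∀ l, l ≠ i → y l = 0 := by
    refine ae_all_iff.2 fun l => ?_
    by_cases hl : l = i
    · simp [hl]
    · have h0 : ∀ᵐ y ∂(η l), y = 0 := by
        rw [hη l hl, ae_dirac_eq]
        simp
      filter_upwards [(measurePreserving_eval η l).quasiMeasurePreserving.ae h0] with y hy _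
      exact hy
  rw [← (measurePreserving_eval η i).lintegral_comp (f := fun y : ℕ => f y)
    (measurable_of_countable _)]
  refine lintegral_congr_ae ?_
  filter_upwards [hzero] with y hy
  rw [Finset.sum_eq_single i (fun l _ hl => by simp [hy l hl]) (by simp)]

lemma isLightTailed_diagonalGeometric (hp0 : p ≠ 0) (hp1 : p ≠ 1) :
    IsLightTailed (diagonalGeometric p) := by
  obtain ⟨θ, hθ, C, hC⟩ := exists_lintegral_exp_geometricMeasure_le hp0 hp1
  refine ⟨θ, hθ, C, fun N => ⟨fun i => ?_, fun j => ?_⟩⟩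
  · rw [lintegral_pi_of_eq_dirac (fun j => (diagonalGeometric p N i j : Measure ℕ)) i
      (fun l hl => diagonalGeometric_of_ne p hl.symm)
      (fun y => ENNReal.ofReal (Real.exp (θ * y))), diagonalGeometric_self]
    exact hC
  · rw [lintegral_pi_of_eq_dirac (fun i => (diagonalGeometric p N i j : Measure ℕ)) j
      (fun l hl => diagonalGeometric_of_ne p hl)
      (fun y => ENNReal.ofReal (Real.exp (θ * y))), diagonalGeometric_self]
    exact hC

lemma meanLoad_diagonalGeometric (hp : p ≠ 0) {N : ℕ} (hN : 1 ≤ N) :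
    meanLoad (diagonalGeometric p N) = ENNReal.ofReal ((1 - p) / p) := by
  have : NeZero N := ⟨by omega⟩
  have hrow : ∀ i : Fin N, ∑ j, ∫⁻ y, (y : ℝ≥0∞) ∂(diagonalGeometric p N i j : Measure ℕ) =
      ENNReal.ofReal ((1 - p) / p) := fun i => by
    rw [Finset.sum_eq_single i (fun j _ hj => by simp [diagonalGeometric_of_ne p hj.symm])
      (by simp), diagonalGeometric_self, lintegral_id_geometricMeasure hp]
  have hcol : ∀ j : Fin N, ∑ i, ∫⁻ y, (y : ℝ≥0∞) ∂(diagonalGeometric p N i j : Measure ℕ) =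
      ENNReal.ofReal ((1 - p) / p) := fun j => by
    rw [Finset.sum_eq_single j (fun i _ hi => by simp [diagonalGeometric_of_ne p hi])
      (by simp), diagonalGeometric_self, lintegral_id_geometricMeasure hp]
  simp only [meanLoad, hrow, hcol, ciSup_const, max_self]

lemma measure_forall_lt_eq {Ω : Type u} [MeasurableSpace Ω] {μ : Measure Ω} {N : ℕ} {lam : ℝ≥0}
    {A : ℝ≥0 → Ω → ℕ} {X : ℕ → Ω → Traffic N} (hp : p ≠ 0)
    (h : IsCoflowTraffic μ lam (diagonalGeometric p N) A X) (n k : ℕ) :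
    μ {ω | ∀ i, X n ω i i < k} = ENNReal.ofReal (1 - (1 - p) ^ k) ^ N := by
  have hinj : Function.Injective fun i : Fin N => (n, i, i) := fun i j hij =>
    (Prod.ext_iff.1 (Prod.ext_iff.1 hij).2).1
  have hind := (h.indep.precomp hinj).meas_iInter
    (s := fun i => {ω | X n ω i i < k}) fun i => ⟨{y | y < k}, MeasurableSet.of_discrete, rfl⟩
  rw [show {ω | ∀ i, X n ω i i < k} = ⋂ i, {ω | X n ω i i < k} by ext; simp, hind,
    Finset.prod_congr rfl fun i _ => ((h.law n i i).measure_eq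
      (p := fun y => y < k) MeasurableSet.of_discrete).trans
        (by rw [diagonalGeometric_self, geometricMeasure_lt hp])]
  simp

/-- If a single diagonal flow reaches `k` with probability at least `1 / N`, then all `N` stay below
`k` with probability at most `(1 - 1 / N) ^ N ≤ exp (-1) ≤ 1 / 2`. -/
lemma half_mul_le_lintegral {Ω : Type u} [MeasurableSpace Ω] {μ : Measure Ω}
    [IsProbabilityMeasure μ] {N : ℕ} {lam : ℝ≥0} {A : ℝ≥0 → Ω → ℕ} {X : ℕ → Ω → Traffic N}
    (hp : p ≠ 0) (h : IsCoflowTraffic μ lam (diagonalGeometric p N) A X) (n : ℕ) {k : ℕ}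
    (hN : 1 ≤ N) (hk : (N : ℝ)⁻¹ ≤ (1 - p) ^ k) :
    (k : ℝ≥0∞) * 2⁻¹ ≤ ∫⁻ ω, (clearanceTime (X n ω) : ℝ≥0∞) ∂μ := by
  have hmeas : MeasurableSet {ω | ∀ i, X n ω i i < k} :=
    (h.measurable n) (MeasurableSet.of_discrete (s := {B : Traffic N | ∀ i, B i i < k}))
  have hprob : μ {ω | ∀ i, X n ω i i < k} ≤ 2⁻¹ := by
    have hN' : (1 : ℝ) ≤ N := by exact_mod_cast hN
    have hinv : (N : ℝ)⁻¹ ≤ 1 := inv_le_one_of_one_le₀ hN'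
    rw [measure_forall_lt_eq hp h]
    calc ENNReal.ofReal (1 - (1 - p) ^ k) ^ N ≤ ENNReal.ofReal (1 - (N : ℝ)⁻¹) ^ N := by
          gcongr
      _ = ENNReal.ofReal ((1 - (N : ℝ)⁻¹) ^ N) := by rw [ENNReal.ofReal_pow (by linarith)]
      _ ≤ ENNReal.ofReal 2⁻¹ := by
          refine ENNReal.ofReal_le_ofReal ?_
          calc (1 - (N : ℝ)⁻¹) ^ N ≤ Real.exp (-(N : ℝ)⁻¹) ^ N :=
                pow_le_pow_left₀ (by linarith) (Real.one_sub_le_exp_neg _) N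
            _ = Real.exp (-1) := by
                rw [← Real.exp_nat_mul, mul_neg, mul_inv_cancel₀ (by positivity)]
            _ ≤ 2⁻¹ := by
                rw [Real.exp_neg]
                exact inv_anti₀ two_pos (by linarith [Real.add_one_le_exp (1 : ℝ)])
      _ = 2⁻¹ := by rw [ENNReal.ofReal_inv_of_pos two_pos, ENNReal.ofReal_ofNat]
  have hcompl : 2⁻¹ ≤ μ {ω | ∀ i, X n ω i i < k}ᶜ := by
    rw [prob_compl_eq_one_sub hmeas]
    refine le_trans (le_of_eq ?_) (tsub_le_tsub_left hprob 1)
    exact ENNReal.one_sub_inv_two.symm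
  calc (k : ℝ≥0∞) * 2⁻¹ ≤ k * μ {ω | ∀ i, X n ω i i < k}ᶜ := mul_le_mul_right hcompl _
    _ = ∫⁻ ω, {ω | ∀ i, X n ω i i < k}ᶜ.indicator (fun _ => (k : ℝ≥0∞)) ω ∂μ := by
        rw [lintegral_indicator_const hmeas.compl]
    _ ≤ _ := by
        refine lintegral_mono fun ω => ?_
        refine Set.indicator_le' (g := fun ω => (clearanceTime (X n ω) : ℝ≥0∞)) ?_ ?_ ω
        · intro ω hω
          simp only [Set.mem_compl_iff, Set.mem_ofPred_eq, not_forall, not_lt] at hω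
          obtain ⟨i, hi⟩ := hω
          refine Nat.cast_le.2 (hi.trans (le_trans ?_ (rowSum_le_clearanceTime (X n ω) i)))
          exact Finset.single_le_sum (f := fun j => X n ω i j) (fun _ _ => Nat.zero_le _)
            (Finset.mem_univ i)
        · exact fun _ _ => zero_le

lemma exists_expectedDelay_ge (hp0 : p ≠ 0) (hp1 : p ≠ 1) (lam : ℝ≥0) :
    ∃ c : ℝ, 0 < c ∧ ∀ᶠ N : ℕ in atTop,
      ∀ (Ω : Type u) [MeasurableSpace Ω] (μ : Measure Ω) [IsProbabilityMeasure μ]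
        (A : ℝ≥0 → Ω → ℕ) (X : ℕ → Ω → Traffic N),
        IsCoflowTraffic μ lam (diagonalGeometric p N) A X →
        ∀ σ : Ω → ℕ → ℕ → Traffic N,
          (∀ᵐ ω ∂μ, IsSchedule (slotCount A ω) (fun m => X m ω) (σ ω)) →
          ∀ n, ENNReal.ofReal (c * Real.log N) ≤ expectedDelay μ A X σ n := by
  have h0 : (0 : ℝ) < p := lt_of_le_of_ne p.2.1 fun h => hp0 (Subtype.ext h.symm)
  have h1 : (p : ℝ) < 1 := lt_of_le_of_ne p.2.2 fun h => hp1 (Subtype.ext h)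
  have hq : (0 : ℝ) < 1 - p := by linarith
  set ℓ : ℝ := -Real.log (1 - p) with hℓ
  have hℓ0 : 0 < ℓ := neg_pos.2 (Real.log_neg hq (by linarith))
  -- One factor `1 / 2` is the probability that some flow reaches `k`; the other covers the rounding
  -- of `log N / ℓ`, which is at least `2` for large `N`.
  refine ⟨1 / (4 * ℓ), by positivity, ?_⟩
  have hlarge : ∀ᶠ N : ℕ in atTop, 2 * ℓ ≤ Real.log N :=
    (Real.tendsto_log_atTop.comp tendsto_natCast_atTop_atTop).eventually_ge_atTop _
  filter_upwards [hlarge, eventually_ge_atTop 1] with N hN hN1 Ω _ μ _ A X h σ hσ n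
  have hN0 : (0 : ℝ) < N := by exact_mod_cast hN1
  set k := ⌊Real.log N / ℓ⌋₊ with hk
  have hk1 : (k : ℝ) ≤ Real.log N / ℓ := Nat.floor_le (by positivity)
  have hk2 : Real.log N / ℓ < k + 1 := Nat.lt_floor_add_one _
  have hpow : (N : ℝ)⁻¹ ≤ (1 - p) ^ k := by
    rw [← Real.exp_log hq, ← Real.exp_nat_mul, ← Real.exp_log (inv_pos.2 hN0), Real.log_inv]
    refine Real.exp_le_exp.2 ?_
    rw [le_div_iff₀ hℓ0] at hk1
    linarith [show (k : ℝ) * ℓ = -(k * Real.log (1 - p)) by rw [hℓ]; ring]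
  calc ENNReal.ofReal (1 / (4 * ℓ) * Real.log N) ≤ ENNReal.ofReal (k * 2⁻¹) := by
        refine ENNReal.ofReal_le_ofReal ?_
        have h2 : 2 ≤ Real.log N / ℓ := by rwa [le_div_iff₀ hℓ0]
        have h3 : 1 / (4 * ℓ) * Real.log N = (Real.log N / ℓ) / 4 := by field_simp
        rw [h3]
        linarith
    _ = k * 2⁻¹ := by
        rw [ENNReal.ofReal_mul (Nat.cast_nonneg _), ENNReal.ofReal_natCast,
          ENNReal.ofReal_inv_of_pos two_pos, ENNReal.ofReal_ofNat]
    _ ≤ ∫⁻ ω, (clearanceTime (X n ω) : ℝ≥0∞) ∂μ := half_mul_le_lintegral hp0 h n hN1 hpow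
    _ ≤ _ := by
        refine lintegral_mono_ae ?_
        filter_upwards [hσ] with ω hω
        exact clearanceTime_le_delay hω n

end LowerBound

end Coflow

theorem mainTheorem1 :
    -- optimal clearance algorithms, which the policy uses, exist
    (∀ N : ℕ, ∃ G : Coflow.Traffic N → ℕ → Coflow.Traffic N, Coflow.IsOptimalClearance G) ∧
    -- stability and delay of the CAB policy
    (∀ (lam rho : ℝ≥0) (ν : (N : ℕ) → Fin N → Fin N → ProbabilityMeasure ℕ),
      0 < lam → rho < 1 → Coflow.IsLightTailed ν →
      (∀ N, (lam : ℝ≥0∞) * Coflow.meanLoad (ν N) ≤ rho) →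
      ∃ T : ℕ → ℕ, (∀ N, 1 ≤ T N) ∧
        ((fun N : ℕ => (T N : ℝ)) =O[atTop] fun N : ℕ => Real.log N) ∧
        (∀ (N : ℕ) (G : Coflow.Traffic N → ℕ → Coflow.Traffic N), Coflow.IsOptimalClearance G →
          ∀ (Ω : Type u) [MeasurableSpace Ω] (μ : Measure Ω) [IsProbabilityMeasure μ]
            (A : ℝ≥0 → Ω → ℕ) (X : ℕ → Ω → Coflow.Traffic N),
            Coflow.IsCoflowTraffic μ lam (ν N) A X →
            (∀ ω, Coflow.IsSchedule (Coflow.slotCount A ω) (fun m => X m ω)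
              (Coflow.cabPolicy G (T N) A X ω)) ∧
            Coflow.IsStable μ A X (Coflow.cabPolicy G (T N) A X)) ∧
        (∃ C : ℝ, ∀ᶠ N : ℕ in atTop,
          ∀ G : Coflow.Traffic N → ℕ → Coflow.Traffic N, Coflow.IsOptimalClearance G →
          ∀ (Ω : Type u) [MeasurableSpace Ω] (μ : Measure Ω) [IsProbabilityMeasure μ]
            (A : ℝ≥0 → Ω → ℕ) (X : ℕ → Ω → Coflow.Traffic N),
            Coflow.IsCoflowTraffic μ lam (ν N) A X →
            Coflow.averageDelay μ A X (Coflow.cabPolicy G (T N) A X) ≤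
              ENNReal.ofReal (C * Real.log N))) ∧
    -- the logarithmic scaling cannot be improved by any scheduling policy
    (∀ lam rho : ℝ≥0, 0 < lam → 0 < rho → rho < 1 →
      ∃ ν : (N : ℕ) → Fin N → Fin N → ProbabilityMeasure ℕ,
        Coflow.IsLightTailed ν ∧
        (∀ N, 1 ≤ N → (lam : ℝ≥0∞) * Coflow.meanLoad (ν N) = rho) ∧
        ∃ c : ℝ, 0 < c ∧ ∀ᶠ N : ℕ in atTop,
          ∀ (Ω : Type u) [MeasurableSpace Ω] (μ : Measure Ω) [IsProbabilityMeasure μ]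
            (A : ℝ≥0 → Ω → ℕ) (X : ℕ → Ω → Coflow.Traffic N),
            Coflow.IsCoflowTraffic μ lam (ν N) A X →
            ∀ σ : Ω → ℕ → ℕ → Coflow.Traffic N,
              (∀ᵐ ω ∂μ, Coflow.IsSchedule (Coflow.slotCount A ω) (fun m => X m ω) (σ ω)) →
              ∀ n, ENNReal.ofReal (c * Real.log N) ≤ Coflow.expectedDelay μ A X σ n) := by
  refine ⟨Coflow.exists_isOptimalClearance, ?_, ?_⟩
  · intro lam rho ν hlam hrho hν hload
    obtain ⟨T, hT, hTlog, hT'⟩ := Coflow.exists_frameSize.{u} hlam hrho hν hload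
    refine ⟨T, hT, hTlog, ?_, ?_⟩
    · intro N G hG Ω _ μ _ A X h
      obtain ⟨hover, B, hB⟩ := hT' N Ω μ A X h
      exact ⟨fun ω => Coflow.isSchedule_cab hG (hT N) (h.slotCount_mono ω),
        h.isStable_cab (hT N) hG hover hB⟩
    · obtain ⟨c, hc⟩ := hTlog.bound
      have hκ : 0 < 1 - Real.exp (-lam) := by
        rw [sub_pos, Real.exp_lt_one_iff]
        exact neg_lt_zero.2 hlam
      refine ⟨c * (2 + (1 - Real.exp (-lam))⁻¹), ?_⟩
      filter_upwards [hc, eventually_ge_atTop 1] with N hN hN1 G hG Ω _ μ _ A X h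
      obtain ⟨hover, -⟩ := hT' N Ω μ A X h
      refine (h.averageDelay_cab_le hlam (hT N) hG hover).trans ?_
      rw [← ENNReal.ofReal_inv_of_pos hκ, ← ENNReal.ofReal_ofNat 2,
        ← ENNReal.ofReal_add zero_le_two (by positivity), ← ENNReal.ofReal_natCast,
        ← ENNReal.ofReal_mul (Nat.cast_nonneg _)]
      refine ENNReal.ofReal_le_ofReal ?_
      rw [Real.norm_of_nonneg (Nat.cast_nonneg _), Real.norm_of_nonneg
        (Real.log_nonneg (by exact_mod_cast hN1))] at hN
      calc (T N : ℝ) * (2 + (1 - Real.exp (-lam))⁻¹)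
          ≤ c * Real.log N * (2 + (1 - Real.exp (-lam))⁻¹) :=
            mul_le_mul_of_nonneg_right hN (by positivity)
        _ = _ := by ring
  · intro lam rho hlam hrho _
    have hl : (0 : ℝ) < lam := hlam
    have hr : (0 : ℝ) < rho := hrho
    -- The geometric mean flow size is then `(1 - p) / p = rho / lam`, so the load is exactly `rho`.
    let p : unitInterval := ⟨lam / (lam + rho), by positivity,
      (div_le_one (by positivity)).2 (by linarith)⟩
    have hp : (p : ℝ) = lam / (lam + rho) := rfl
    have hp0 : p ≠ 0 := fun h => by
      have : (p : ℝ) = 0 := congrArg Subtype.val h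
      rw [hp] at this
      exact absurd this (by positivity)
    have hp1 : p ≠ 1 := fun h => by
      have : (p : ℝ) = 1 := congrArg Subtype.val h
      rw [hp, div_eq_one_iff_eq (by positivity)] at this
      linarith
    refine ⟨Coflow.diagonalGeometric p, Coflow.isLightTailed_diagonalGeometric hp0 hp1,
      fun N hN => ?_, Coflow.exists_expectedDelay_ge hp0 hp1 lam⟩
    rw [Coflow.meanLoad_diagonalGeometric hp0 hN, ← ENNReal.ofReal_coe_nnreal,
      ← ENNReal.ofReal_mul hl.le, ← ENNReal.ofReal_coe_nnreal, hp]
    congr 1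
    field_simp
    ring
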